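/- **Proposition (blocking probability under a uniform price).** Consider a loss system with $K$ identical servers. Job $n\ge1$ arrives at time $A_n=U_1+\dots+U_n$, where the interarrival times $U_n\ge 0$ are i.i.d. with mean $1/\lambda\in(0,\infty)$ and Laplace–Stieltjes transform $\varphi(s)=\mathbb E[e^{-sU_1}]$. Jobs have i.i.d. exponential service times of rate $\mu>0$ and i.i.d. valuations $V_n$, and $\overline G(x)=\mathbb P(V_1\ge x)$. At time $0$ a possibly random number $X_0\le K$ of servers is busy, with i.i.d. exponential remaining service times of rate $\mu$. The remaining service times, interarrival times, service times and valuations are mutually independent, and $X_0$ is independent of all of them. The admission price is a constant $p$ (a uniform price): job $n$ is admitted, and occupies one server for its service time, if and only if fewer than $K$ servers are busy when it arrives and $V_n\ge p$; otherwise it leaves and never returns. Let $Z_n$ be the number of busy servers that job $n$ finds just before its own admission decision (jobs arriving at the same time are treated one after another in the order of their indices). Put $$\beta_j=\prod_{m=1}^{j}\frac{1-\varphi(m\mu)}{\varphi(m\mu)},\qquad 0\le j\le K.$$ If $\overline G(p)>0$, then the limiting probability that an arriving job finds all $K$ servers busy exists and is $$\pi_K(p)=\lim_{n\to\infty}\mathbb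 P(Z_n=K)=\Bigl(\sum_{j=0}^{K}\binom Kj\,\overline G(p)^{-j}\beta_j\Bigr)^{-1}.$$ If $\overline G(p)=0$ and $K\ge1$, then $\lim_{n\to\infty}\mathbb P(Z_n=K)=0$ (the formula with the sum read as $+\infty$). -/

import Mathlib

open MeasureTheory ProbabilityTheory Filter Topology

namespace LossSystem

/-- The instant `U 0 + ⋯ + U n` at which job `n` arrives, for the interarrival times `u`.
Jobs are numbered from `0`, and `u 0` is the time from the origin to the first arrival. -/
noncomputable def arrivalTime (u : ℕ → ℝ) (n : ℕ) : ℝ :=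
  ∑ i ∈ Finset.range (n + 1), u i

/-- The number of jobs in service just before time `t` (the left limit at `t`), when
* `x₀` jobs are in service at time `0`, with remaining service times `r 0, …, r (x₀ - 1)`;
* `J` is the set of jobs admitted so far, where job `m` has service time `s m`.
Job `m` leaves at time `arrivalTime u m + s m`. -/
noncomputable def numBusy (x₀ : ℕ) (r u s : ℕ → ℝ) (J : Finset ℕ) (t : ℝ) : ℕ :=
  ((Finset.range x₀).filter fun i => t ≤ r i).card +
    (J.filter fun m => t ≤ arrivalTime u m + s m).card

open Classical in
/-- The set of admitted jobs among the jobs `0, …, n - 1` in the `K`-server loss system in which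
the admission price is `price k` when `k < K` servers are busy. Job `n`, with valuation `v n`, is
admitted iff the number `k` of busy servers that it finds is less than `K` and `price k ≤ v n`;
otherwise it leaves for ever. -/
noncomputable def admitted (K : ℕ) (price : Fin K → ℝ) (x₀ : ℕ) (r u s v : ℕ → ℝ) :
    ℕ → Finset ℕ
  | 0 => ∅
  | n + 1 =>
    let J := admitted K price x₀ r u s v n
    if ∃ h : numBusy x₀ r u s J (arrivalTime u n) < K,
        price ⟨numBusy x₀ r u s J (arrivalTime u n), h⟩ ≤ v n
    then insert n J else J

/-- The number of busy servers found by job `n` on its arrival. -/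
noncomputable def busySeen (K : ℕ) (price : Fin K → ℝ) (x₀ : ℕ) (r u s v : ℕ → ℝ) (n : ℕ) : ℕ :=
  numBusy x₀ r u s (admitted K price x₀ r u s v n) (arrivalTime u n)

/-- The Laplace–Stieltjes transform `s ↦ E[exp (-s X)]` of a random variable `X`. -/
noncomputable def lst {Ω : Type*} [MeasurableSpace Ω] (P : Measure Ω) (X : Ω → ℝ) (s : ℝ) : ℝ :=
  ∫ ω, Real.exp (-(s * X ω)) ∂P

/-- `β_j = ∏_{m=1}^j (1 - φ(mμ)) / φ(mμ)`. -/
noncomputable def beta (φ : ℝ → ℝ) (μ : ℝ) (j : ℕ) : ℝ :=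
  ∏ m ∈ Finset.Icc 1 j, (1 - φ (m * μ)) / φ (m * μ)

/-- The tail probability `P (X ≥ x)`. -/
noncomputable def tail {Ω : Type*} [MeasurableSpace Ω] (P : Measure Ω) (X : Ω → ℝ) (x : ℝ) : ℝ :=
  P.real {ω | x ≤ X ω}

end LossSystem

/-! Write q for the probability that a valuation reaches the price. The numbers of busy servers
found by successive jobs form a Markov chain on {0, …, K}. From state i < K the state rises by one
with probability q. During the next interarrival time t, by lack of memory, each job in service
survives independently with probability exp(-μt). A step is thus an admission decision followed by
binomial thinning with random parameter exp(-μU).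

Thinning is diagonal on binomial moments: the k-th binomial moment of Bin(y, x) is C(y,k) x^k, and
averaging over U turns x^k into φ(kμ) (`sum_survivalWeight_mul_choose`). For a stationary law L with
moments B_k = ∑ L_i C(i,k), Pascal's rule gives B_{k+1} = φ((k+1)μ) (B_{k+1} + q (B_k - C(K,k)
B_K)). The subtracted term corrects for the full state, where nobody is admitted, and B_K = L_K is
the blocking probability. With B_0 = 1 this first-order recursion telescopes to the formula
(`top_moment_eq`); for q = 0 it forces B_K = 0, because φ(Kμ) < 1. Convergence to L is a Doeblin
argument (`exists_tendsto_of_minorization`): U is not a.s. zero, so from every state the system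
empties before the next arrival with probability at least E[(1 - exp(-μU))^K] > 0.

Most of the work derives the transition law from the pathwise definition of the system. For frozen
interarrival times and valuations, `measureReal_served_and_busyCount` conditions on the set T of
jobs in service: this event is the intersection of an event about the lifetimes outside T with the
event that each job in T has outlived its age. Fubini's theorem then restores the randomness of the
frozen data (`measureReal_busy_succ_eq_integral`), and the independence of the current state, the
current valuation and the next interarrival time factors the result (`measureReal_busy_succ`). -/

namespace LossSystem

/-! ### Binomial weights and their binomial moments. -/

/-- The probability that a binomial random variable with parameters `y` and `x` equals `j`. -/
noncomputable def binomialWeight (y j : ℕ) (x : ℝ) : ℝ :=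
  y.choose j * x ^ j * (1 - x) ^ (y - j)

lemma binomialWeight_nonneg {x : ℝ} (h0 : 0 ≤ x) (h1 : x ≤ 1) (y j : ℕ) :
    0 ≤ binomialWeight y j x := by
  have := sub_nonneg.2 h1
  unfold binomialWeight
  positivity

/-- The binomial moments of the binomial distribution. -/
lemma sum_binomialWeight_mul_choose {y N : ℕ} (hy : y ≤ N) (k : ℕ) (x : ℝ) :
    ∑ j ∈ Finset.range (N + 1), binomialWeight y j x * (j.choose k : ℝ) =
      (y.choose k : ℝ) * x ^ k := by
  have h1 : ∑ j ∈ Finset.range (N + 1), binomialWeight y j x * (j.choose k : ℝ) =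
      ∑ j ∈ Finset.range (y + 1), binomialWeight y j x * (j.choose k : ℝ) := by
    symm
    apply Finset.sum_subset
    · intro j hj
      simp only [Finset.mem_range] at hj ⊢
      omega
    · intro j _ hj
      have : y < j := by simp only [Finset.mem_range] at hj; omega
      simp [binomialWeight, Nat.choose_eq_zero_of_lt this]
  rw [h1]
  rcases lt_or_ge y k with hk | hk
  · rw [Nat.choose_eq_zero_of_lt hk]
    simp only [Nat.cast_zero, zero_mul]
    refine Finset.sum_eq_zero fun j hj => ?_
    have : j < k := lt_of_lt_of_le (Finset.mem_range.1 hj) hk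
    simp [Nat.choose_eq_zero_of_lt this]
  · obtain ⟨d, rfl⟩ := Nat.exists_eq_add_of_le hk
    rw [show k + d + 1 = k + (d + 1) by ring, Finset.sum_range_add]
    have h2 : ∑ j ∈ Finset.range k, binomialWeight (k + d) j x * (j.choose k : ℝ) = 0 := by
      refine Finset.sum_eq_zero fun j hj => ?_
      simp [Nat.choose_eq_zero_of_lt (Finset.mem_range.1 hj)]
    have h3 := add_pow x (1 - x) d
    rw [add_sub_cancel, one_pow] at h3
    rw [h2, zero_add, ← mul_one (((k + d).choose k : ℝ) * x ^ k), h3, Finset.mul_sum]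
    refine Finset.sum_congr rfl fun i hi => ?_
    -- Trinomial revision C(k+d,k+i) C(k+i,k) = C(k+d,k) C(d,i) reduces the sum to the binomial
    -- theorem for (x + (1 - x))^d.
    have h4 := Nat.choose_mul (n := k + d) (k := k + i) (s := k) (by omega)
    simp only [Nat.add_sub_cancel_left] at h4
    have h5 : ((k + d).choose (k + i) : ℝ) * ((k + i).choose k : ℝ) =
        ((k + d).choose k : ℝ) * (d.choose i : ℝ) := by exact_mod_cast h4
    rw [binomialWeight, Nat.add_sub_add_left, pow_add]
    linear_combination (x ^ k * x ^ i * (1 - x) ^ (d - i)) * h5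

lemma sum_binomialWeight {y N : ℕ} (hy : y ≤ N) (x : ℝ) :
    ∑ j ∈ Finset.range (N + 1), binomialWeight y j x = 1 := by
  simpa using sum_binomialWeight_mul_choose hy 0 x

lemma binomialWeight_le_one {x : ℝ} (h0 : 0 ≤ x) (h1 : x ≤ 1) (y j : ℕ) :
    binomialWeight y j x ≤ 1 := by
  rw [← sum_binomialWeight (le_max_left y j) x]
  exact Finset.single_le_sum (f := fun j => binomialWeight y j x)
    (fun i _ => binomialWeight_nonneg h0 h1 y i)
    (Finset.mem_range.2 (Nat.lt_succ_of_le (le_max_right y j)))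

/-! ### Convergence of the chain and solution of the moment recursion. -/

/-- The distributions of a finite Markov chain converge if all states lead in one step to the
state `0` with a probability bounded below. -/
theorem exists_tendsto_of_minorization {K : ℕ} {M : ℕ → ℕ → ℝ} {ε : ℝ} (hε : 0 < ε)
    (hM : ∀ i ≤ K, ∀ j, 0 ≤ M i j)
    (hM1 : ∀ i ≤ K, ∑ j ∈ Finset.range (K + 1), M i j = 1)
    (hM0 : ∀ i ≤ K, ε ≤ M i 0) {π : ℕ → ℕ → ℝ}
    (hrec : ∀ n j, j ≤ K → π (n + 1) j = ∑ i ∈ Finset.range (K + 1), π n i * M i j)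
    (hmass : ∀ n, ∑ i ∈ Finset.range (K + 1), π n i = 1) :
    ∃ L : ℕ → ℝ, ∀ j ≤ K, Tendsto (fun n => π n j) atTop (𝓝 (L j)) := by
  set δ : ℕ → ℕ → ℝ := fun n j => π (n + 1) j - π n j with hδ
  -- Doeblin splitting: the mass ε that every row sends to state 0 is removed, which leaves a
  -- nonnegative matrix with row sums 1 - ε.
  set N : ℕ → ℕ → ℝ := fun i j => M i j - if j = 0 then ε else 0 with hN
  have hN0 : ∀ i ≤ K, ∀ j, 0 ≤ N i j := by
    intro i hi j
    simp only [hN]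
    split_ifs with h
    · subst h; linarith [hM0 i hi]
    · simpa using hM i hi j
  have hN1 : ∀ i ≤ K, ∑ j ∈ Finset.range (K + 1), N i j = 1 - ε := by
    intro i hi
    simp only [hN, Finset.sum_sub_distrib, hM1 i hi]
    simp
  have hδ0 : ∀ n, ∑ i ∈ Finset.range (K + 1), δ n i = 0 := by
    intro n
    simp [hδ, Finset.sum_sub_distrib, hmass]
  -- The increments δ have total mass zero, so the removed rank-one part acts on them as zero. They
  -- evolve by `N` alone and contract in ℓ¹ by the factor 1 - ε.
  have hδrec : ∀ n j, j ≤ K → δ (n + 1) j = ∑ i ∈ Finset.range (K + 1), δ n i * N i j := by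
    intro n j hj
    have : ∑ i ∈ Finset.range (K + 1), δ n i * N i j =
        ∑ i ∈ Finset.range (K + 1), δ n i * M i j -
          (∑ i ∈ Finset.range (K + 1), δ n i) * (if j = 0 then ε else 0) := by
      rw [Finset.sum_mul, ← Finset.sum_sub_distrib]
      exact Finset.sum_congr rfl fun i _ => by simp only [hN]; ring
    rw [this, hδ0, zero_mul, sub_zero]
    simp only [hδ, sub_mul, Finset.sum_sub_distrib]
    rw [← hrec n j hj, ← hrec (n + 1) j hj]
  have hcontr : ∀ n, ∑ j ∈ Finset.range (K + 1), |δ (n + 1) j| ≤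
      (1 - ε) * ∑ i ∈ Finset.range (K + 1), |δ n i| := by
    intro n
    calc ∑ j ∈ Finset.range (K + 1), |δ (n + 1) j|
        ≤ ∑ j ∈ Finset.range (K + 1), ∑ i ∈ Finset.range (K + 1), |δ n i| * N i j := by
          refine Finset.sum_le_sum fun j hj => ?_
          rw [hδrec n j (Nat.lt_succ_iff.1 (Finset.mem_range.1 hj))]
          refine (Finset.abs_sum_le_sum_abs _ _).trans (Finset.sum_le_sum fun i hi => ?_)
          rw [abs_mul, abs_of_nonneg (hN0 i (Nat.lt_succ_iff.1 (Finset.mem_range.1 hi)) j)]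
      _ = (1 - ε) * ∑ i ∈ Finset.range (K + 1), |δ n i| := by
          rw [Finset.sum_comm, Finset.mul_sum]
          refine Finset.sum_congr rfl fun i hi => ?_
          rw [← Finset.mul_sum, hN1 i (Nat.lt_succ_iff.1 (Finset.mem_range.1 hi)), mul_comm]
  have hε1 : 0 ≤ 1 - ε := by
    rw [← hN1 0 (Nat.zero_le K)]
    exact Finset.sum_nonneg fun j _ => hN0 0 (Nat.zero_le K) j
  have hgeom : ∀ n, ∑ j ∈ Finset.range (K + 1), |δ n j| ≤
      (∑ j ∈ Finset.range (K + 1), |δ 0 j|) * (1 - ε) ^ n := by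
    intro n
    induction n with
    | zero => simp
    | succ n ih =>
      refine (hcontr n).trans ((mul_le_mul_of_nonneg_left ih hε1).trans (le_of_eq ?_))
      ring
  have hlim : ∀ j, ∃ l, j ≤ K → Tendsto (fun n => π n j) atTop (𝓝 l) := by
    intro j
    by_cases hj : j ≤ K
    · have : CauchySeq fun n => π n j := by
        refine cauchySeq_of_le_geometric (1 - ε) (∑ j ∈ Finset.range (K + 1), |δ 0 j|)
          (by linarith) fun n => ?_
        rw [dist_comm, Real.dist_eq]
        refine le_trans ?_ (hgeom n)
        exact Finset.single_le_sum (f := fun j => |δ n j|) (fun i _ => abs_nonneg _)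
          (Finset.mem_range.2 (Nat.lt_succ_of_le hj))
      obtain ⟨l, hl⟩ := cauchySeq_tendsto_of_complete this
      exact ⟨l, fun _ => hl⟩
    · exact ⟨0, fun h => absurd h hj⟩
  choose L hL using hlim
  exact ⟨L, hL⟩

/-- Solution of the recursion for the stationary binomial moments, with positive admission
probability. -/
lemma top_moment_eq {K : ℕ} {B c : ℕ → ℝ} {q : ℝ} (hq : 0 < q)
    (hB0 : B 0 = 1)
    (hB : ∀ k < K, c (k + 1) * B (k + 1) = q * (B k - (K.choose k : ℝ) * B K)) :
    B K = (∑ j ∈ Finset.range (K + 1), (K.choose j : ℝ) * q⁻¹ ^ j *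
      ∏ m ∈ Finset.Icc 1 j, c m)⁻¹ := by
  -- With b_k = q^{-k} c_1 ⋯ c_k the recursion reads b_{k+1} B_{k+1} = b_k B_k - C(K,k) b_k B_K,
  -- which telescopes. At k = K the left side is the missing term j = K of the sum, as C(K,K) = 1.
  have key : ∀ k ≤ K, q⁻¹ ^ k * (∏ m ∈ Finset.Icc 1 k, c m) * B k =
      1 - B K * ∑ j ∈ Finset.range k, (K.choose j : ℝ) * q⁻¹ ^ j * ∏ m ∈ Finset.Icc 1 j, c m := by
    intro k
    induction k with
    | zero => simp [hB0]
    | succ k ih =>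
      intro hk
      have h1 := ih (by omega)
      have h2 := hB k hk
      rw [Finset.sum_range_succ, Finset.prod_Icc_succ_top (by omega), pow_succ]
      have h3 : q⁻¹ * q = 1 := inv_mul_cancel₀ hq.ne'
      linear_combination h1 + (q⁻¹ ^ k * q⁻¹ * ∏ m ∈ Finset.Icc 1 k, c m) * h2 +
        (q⁻¹ ^ k * (∏ m ∈ Finset.Icc 1 k, c m) * (B k - (K.choose k : ℝ) * B K)) * h3
  have hK := key K le_rfl
  refine eq_inv_of_mul_eq_one_left ?_
  rw [Finset.sum_range_succ, Nat.choose_self]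
  push_cast
  linear_combination hK

/-! ### Pathwise dynamics in terms of the set of jobs in service. -/

/-- The number of busy servers just after the decision on a job with valuation `x` that finds `i`
busy servers, at the uniform price `p`. -/
noncomputable def afterDecision (K : ℕ) (p : ℝ) (i : ℕ) (x : ℝ) : ℕ :=
  if i < K ∧ p ≤ x then i + 1 else i

/-- The time at which service starts: `0` for the initial jobs `Sum.inl i`, the arrival time for
the job `Sum.inr m`. -/
noncomputable def startTime (u : ℕ → ℝ) : ℕ ⊕ ℕ → ℝ :=
  Sum.elim (fun _ => 0) (arrivalTime u)

/-- The set of jobs in service just before time `t`, if `d` gives the (remaining) service times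
and `J` is the set of admitted jobs. -/
noncomputable def present (x₀ : ℕ) (u : ℕ → ℝ) (d : ℕ ⊕ ℕ → ℝ) (J : Finset ℕ) (t : ℝ) :
    Finset (ℕ ⊕ ℕ) :=
  ((Finset.range x₀).disjSum J).filter fun l => t ≤ startTime u l + d l

/-- The set `admitted`, at the uniform price `p`, in terms of the joint family `d` of the
remaining service times of the initial jobs and of the service times. -/
noncomputable def admittedJobs (K : ℕ) (p : ℝ) (x₀ : ℕ) (u v : ℕ → ℝ) (d : ℕ ⊕ ℕ → ℝ) (n : ℕ) :
    Finset ℕ :=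
  admitted K (fun _ => p) x₀ (fun i => d (.inl i)) u (fun m => d (.inr m)) v n

/-- The number `busySeen`, at the uniform price `p`, in terms of the joint family `d` of the
remaining service times of the initial jobs and of the service times. -/
noncomputable def busyCount (K : ℕ) (p : ℝ) (x₀ : ℕ) (u v : ℕ → ℝ) (d : ℕ ⊕ ℕ → ℝ) (n : ℕ) : ℕ :=
  busySeen K (fun _ => p) x₀ (fun i => d (.inl i)) u (fun m => d (.inr m)) v n

/-- The set of jobs in service just after the decision on job `n`. -/
noncomputable def served (K : ℕ) (p : ℝ) (x₀ : ℕ) (u v : ℕ → ℝ) (d : ℕ ⊕ ℕ → ℝ) (n : ℕ) :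
    Finset (ℕ ⊕ ℕ) :=
  present x₀ u d (admittedJobs K p x₀ u v d (n + 1)) (arrivalTime u n)

section Dynamics

variable {K : ℕ} {p : ℝ} {x₀ : ℕ} {u v : ℕ → ℝ} {d : ℕ ⊕ ℕ → ℝ} {n : ℕ}

lemma inl_mem_present {J : Finset ℕ} {t : ℝ} {i : ℕ} :
    Sum.inl i ∈ present x₀ u d J t ↔ i < x₀ ∧ t ≤ d (.inl i) := by
  rw [present, Finset.mem_filter]
  simp [startTime]

lemma inr_mem_present {J : Finset ℕ} {t : ℝ} {m : ℕ} :
    Sum.inr m ∈ present x₀ u d J t ↔ m ∈ J ∧ t ≤ arrivalTime u m + d (.inr m) := by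
  rw [present, Finset.mem_filter]
  simp [startTime]

lemma busyCount_eq_card : busyCount K p x₀ u v d n =
    (present x₀ u d (admittedJobs K p x₀ u v d n) (arrivalTime u n)).card := by
  rw [busyCount, busySeen, numBusy, ← Finset.card_disjSum]
  congr 1
  ext l
  rcases l with i | m
  · rw [inl_mem_present, Finset.inl_mem_disjSum, Finset.mem_filter, Finset.mem_range]
  · rw [inr_mem_present, Finset.inr_mem_disjSum, Finset.mem_filter, admittedJobs]

lemma admittedJobs_zero : admittedJobs K p x₀ u v d 0 = ∅ := rfl

lemma admittedJobs_succ : admittedJobs K p x₀ u v d (n + 1) =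
    if busyCount K p x₀ u v d n < K ∧ p ≤ v n then insert n (admittedJobs K p x₀ u v d n)
    else admittedJobs K p x₀ u v d n := by
  simp only [admittedJobs, busyCount, busySeen, admitted, exists_prop]
  congr

lemma lt_of_mem_admittedJobs {m : ℕ} (h : m ∈ admittedJobs K p x₀ u v d n) : m < n := by
  induction n with
  | zero => simp [admittedJobs_zero] at h
  | succ n ih =>
    rw [admittedJobs_succ] at h
    split_ifs at h
    · rcases Finset.mem_insert.1 h with h | h
      · omega
      · exact (ih h).trans n.lt_succ_self
    · exact (ih h).trans n.lt_succ_self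

lemma arrivalTime_succ : arrivalTime u (n + 1) = arrivalTime u n + u (n + 1) :=
  Finset.sum_range_succ _ _

lemma monotone_arrivalTime (hu : ∀ i, 0 ≤ u i) : Monotone (arrivalTime u) :=
  monotone_nat_of_le_succ fun n => by
    rw [arrivalTime_succ]
    exact le_add_of_nonneg_right (hu _)

lemma arrivalTime_nonneg (hu : ∀ i, 0 ≤ u i) : 0 ≤ arrivalTime u n :=
  Finset.sum_nonneg fun i _ => hu i

lemma present_filter {J : Finset ℕ} {t t' : ℝ} (h : t ≤ t') :
    (present x₀ u d J t).filter (fun l => t' ≤ startTime u l + d l) = present x₀ u d J t' := by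
  rw [present, present, Finset.filter_filter]
  refine Finset.filter_congr fun l _ => ?_
  exact ⟨fun hl => hl.2, fun hl => ⟨h.trans hl, hl⟩⟩

/-- Between the decision on job n and the arrival of job n + 1 nobody is admitted, so the only
change is the loss of the jobs that finish. -/
lemma busyCount_succ (hu : ∀ i, 0 ≤ u i) : busyCount K p x₀ u v d (n + 1) =
    ((served K p x₀ u v d n).filter
      fun l => arrivalTime u (n + 1) ≤ startTime u l + d l).card := by
  rw [busyCount_eq_card, served, present_filter (monotone_arrivalTime hu n.le_succ)]

/-- Nonnegative service times ensure that a job just admitted counts as present at its own arrival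
time; it is new because earlier admitted jobs have smaller indices. -/
lemma card_served (hd : ∀ l, 0 ≤ d l) : (served K p x₀ u v d n).card =
    afterDecision K p (busyCount K p x₀ u v d n) (v n) := by
  rw [afterDecision, served, admittedJobs_succ]
  split_ifs
  · have h1 : present x₀ u d (insert n (admittedJobs K p x₀ u v d n)) (arrivalTime u n) =
        insert (Sum.inr n) (present x₀ u d (admittedJobs K p x₀ u v d n) (arrivalTime u n)) := by
      ext l
      rcases l with i | m
      · simp [inl_mem_present]
      · simp only [inr_mem_present, Finset.mem_insert, Sum.inr.injEq]
        constructor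
        · rintro ⟨rfl | h, h'⟩
          · exact Or.inl rfl
          · exact Or.inr ⟨h, h'⟩
        · rintro (rfl | h)
          · exact ⟨Or.inl rfl, le_add_of_nonneg_right (hd _)⟩
          · exact ⟨Or.inr h.1, h.2⟩
    rw [h1, Finset.card_insert_of_notMem, busyCount_eq_card]
    intro h
    exact lt_irrefl _ (lt_of_mem_admittedJobs (inr_mem_present.1 h).1)
  · rw [busyCount_eq_card]

lemma afterDecision_le {i : ℕ} (hi : i ≤ K) (x : ℝ) : afterDecision K p i x ≤ K := by
  unfold afterDecision
  split_ifs <;> omega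

lemma busyCount_le (hu : ∀ i, 0 ≤ u i) (hd : ∀ l, 0 ≤ d l) (hx₀ : x₀ ≤ K) (n : ℕ) :
    busyCount K p x₀ u v d n ≤ K := by
  induction n with
  | zero =>
    rw [busyCount_eq_card, admittedJobs_zero, present]
    refine (Finset.card_filter_le _ _).trans ?_
    simpa using hx₀
  | succ n ih =>
    rw [busyCount_succ hu]
    refine (Finset.card_filter_le _ _).trans ?_
    rw [card_served hd]
    exact afterDecision_le ih _

/-- The jobs served at the arrival of job `n` do not depend on the exact service times of jobs
that last longer. -/
lemma served_congr (hu : ∀ i, 0 ≤ u i) {d' : ℕ ⊕ ℕ → ℝ}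
    (h : ∀ l, d l = d' l ∨ (arrivalTime u n ≤ startTime u l + d l ∧
      arrivalTime u n ≤ startTime u l + d' l)) :
    served K p x₀ u v d n = served K p x₀ u v d' n := by
  have hpres : ∀ J, ∀ k ≤ n, present x₀ u d J (arrivalTime u k) =
      present x₀ u d' J (arrivalTime u k) := by
    intro J k hk
    refine Finset.filter_congr fun l _ => ?_
    rcases h l with h | h
    · rw [h]
    · have := monotone_arrivalTime hu hk
      exact ⟨fun _ => this.trans h.2, fun _ => this.trans h.1⟩
  -- The range reaches n + 1 because `served` includes the decision on job n; every decision
  -- involved looks only at times up to the arrival of job n, where both families of lifetimes give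
  -- the same presence.
  have hadm : ∀ k ≤ n + 1, admittedJobs K p x₀ u v d k = admittedJobs K p x₀ u v d' k := by
    intro k
    induction k with
    | zero => intro _; rfl
    | succ k ih =>
      intro hk
      rw [admittedJobs_succ, admittedJobs_succ, busyCount_eq_card, busyCount_eq_card,
        ih (by omega), hpres _ k (by omega)]
  rw [served, served, hadm _ le_rfl, hpres _ n le_rfl]

/-- The number of busy servers found by job `n` is determined by the interarrival times up to
its arrival and by the valuations of the preceding jobs. -/
lemma busyCount_congr {u' v' : ℕ → ℝ} (hu : ∀ i ≤ n, u i = u' i) (hv : ∀ i < n, v i = v' i) :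
    busyCount K p x₀ u v d n = busyCount K p x₀ u' v' d n := by
  have htime : ∀ k ≤ n, arrivalTime u k = arrivalTime u' k := by
    intro k hk
    refine Finset.sum_congr rfl fun i hi => hu i ?_
    have := Finset.mem_range.1 hi
    omega
  have hpres : ∀ J : Finset ℕ, (∀ m ∈ J, m < n) → ∀ k ≤ n, present x₀ u d J (arrivalTime u k) =
      present x₀ u' d J (arrivalTime u' k) := by
    intro J hJ k hk
    ext l
    rcases l with i | m
    · rw [inl_mem_present, inl_mem_present, htime k hk]
    · rw [inr_mem_present, inr_mem_present]
      refine and_congr_right fun hm => ?_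
      rw [htime k hk, htime m (hJ m hm).le]
  have hadm : ∀ k ≤ n, admittedJobs K p x₀ u v d k = admittedJobs K p x₀ u' v' d k := by
    intro k
    induction k with
    | zero => intro _; rfl
    | succ k ih =>
      intro hk
      rw [admittedJobs_succ, admittedJobs_succ, busyCount_eq_card, busyCount_eq_card,
        ih (by omega), hv k (by omega), hpres _ _ k (by omega)]
      intro m hm
      have := lt_of_mem_admittedJobs hm
      omega
  rw [busyCount_eq_card, busyCount_eq_card, hadm n le_rfl, hpres _ _ n le_rfl]
  exact fun m hm => lt_of_mem_admittedJobs hm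

/-! ### Measurability of the path functionals. -/

section Measurability

variable {α : Type*} {mα : MeasurableSpace α}

lemma measurableSet_finset_eq {ι : Type*} [Countable ι] {F : α → Finset ι}
    (h : ∀ l, MeasurableSet {a | l ∈ F a}) (T : Finset ι) : MeasurableSet {a | F a = T} := by
  have : {a | F a = T} = ⋂ l, {a | l ∈ F a ↔ l ∈ T} := by
    ext a
    simp [Finset.ext_iff]
  rw [this]
  refine MeasurableSet.iInter fun l => ?_
  by_cases hl : l ∈ T
  · simpa [hl] using h l
  · simp only [hl, iff_false]
    exact (h l).compl

/-- A countable type has only countably many finite subsets, so measurability of the membership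
events suffices for every function of a random finite set. -/
lemma measurable_comp_finset {ι β : Type*} [Countable ι] [MeasurableSpace β] {F : α → Finset ι}
    (h : ∀ l, MeasurableSet {a | l ∈ F a}) (g : Finset ι → β) : Measurable fun a => g (F a) := by
  intro s _
  have : (fun a => g (F a)) ⁻¹' s = ⋃ T ∈ {T | g T ∈ s}, {a | F a = T} := by
    ext a
    simp
  rw [this]
  exact MeasurableSet.biUnion (Set.to_countable _) fun T _ => measurableSet_finset_eq h T

variable {X : α → ℕ} {U V : α → ℕ → ℝ} {D : α → ℕ ⊕ ℕ → ℝ}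

lemma measurable_arrivalTime (hU : Measurable U) (n : ℕ) :
    Measurable fun a => arrivalTime (U a) n :=
  Finset.measurable_sum _ fun i _ => (measurable_pi_apply i).comp hU

lemma measurableSet_mem_present (hX : Measurable X) (hU : Measurable U) (hD : Measurable D)
    {J : α → Finset ℕ} (hJ : ∀ m, MeasurableSet {a | m ∈ J a}) {t : α → ℝ} (ht : Measurable t)
    (l : ℕ ⊕ ℕ) : MeasurableSet {a | l ∈ present (X a) (U a) (D a) (J a) (t a)} := by
  have hDl : ∀ l, Measurable fun a => D a l := fun l => (measurable_pi_apply l).comp hD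
  rcases l with i | m
  · simp only [inl_mem_present]
    exact (hX (measurableSet_Ioi (a := i))).inter (measurableSet_le ht (hDl _))
  · simp only [inr_mem_present]
    exact (hJ m).inter (measurableSet_le ht ((measurable_arrivalTime hU m).add (hDl _)))

lemma measurableSet_mem_admittedJobs (hX : Measurable X) (hU : Measurable U) (hV : Measurable V)
    (hD : Measurable D) (n m : ℕ) :
    MeasurableSet {a | m ∈ admittedJobs K p (X a) (U a) (V a) (D a) n} := by
  induction n generalizing m with
  | zero => simp [admittedJobs_zero]
  | succ n ih =>
    have hb : Measurable fun a => busyCount K p (X a) (U a) (V a) (D a) n := by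
      simp only [busyCount_eq_card]
      exact measurable_comp_finset (measurableSet_mem_present hX hU hD ih
        (measurable_arrivalTime hU n)) _
    have : {a | m ∈ admittedJobs K p (X a) (U a) (V a) (D a) (n + 1)} =
        {a | m ∈ admittedJobs K p (X a) (U a) (V a) (D a) n} ∪
          ({a | busyCount K p (X a) (U a) (V a) (D a) n < K} ∩ {a | p ≤ V a n} ∩
            {_a | m = n}) := by
      ext a
      simp only [admittedJobs_succ, Set.mem_ofPred_eq, Set.mem_union, Set.mem_inter_iff]
      split_ifs with h
      · simp only [Finset.mem_insert, h, true_and, and_self]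
        tauto
      · tauto
    rw [this]
    exact (ih m).union (((hb (measurableSet_Iio (a := K))).inter
      (measurableSet_le measurable_const ((measurable_pi_apply n).comp hV))).inter
        (MeasurableSet.const _))

lemma measurable_busyCount (hX : Measurable X) (hU : Measurable U) (hV : Measurable V)
    (hD : Measurable D) (n : ℕ) :
    Measurable fun a => busyCount K p (X a) (U a) (V a) (D a) n := by
  simp only [busyCount_eq_card]
  exact measurable_comp_finset (measurableSet_mem_present hX hU hD
    (measurableSet_mem_admittedJobs hX hU hV hD n) (measurable_arrivalTime hU n)) _

lemma measurable_comp_served {β : Type*} [MeasurableSpace β] (hX : Measurable X)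
    (hU : Measurable U) (hV : Measurable V) (hD : Measurable D) (n : ℕ)
    (g : Finset (ℕ ⊕ ℕ) → β) :
    Measurable fun a => g (served K p (X a) (U a) (V a) (D a) n) :=
  measurable_comp_finset (measurableSet_mem_present hX hU hD
    (measurableSet_mem_admittedJobs hX hU hV hD (n + 1)) (measurable_arrivalTime hU n)) g

/-- The σ-algebra on the sample space is arbitrary, which permits its use with the σ-algebra
generated by only part of the lifetimes. -/
lemma measurableSet_served_eq (hD : ∀ l, Measurable fun a => D a l) (n : ℕ)
    (T : Finset (ℕ ⊕ ℕ)) : MeasurableSet {a | served K p x₀ u v (D a) n = T} :=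
  measurableSet_finset_eq (measurableSet_mem_present (X := fun _ => x₀) (U := fun _ => u)
    measurable_const measurable_const (measurable_pi_lambda _ hD)
    (measurableSet_mem_admittedJobs (V := fun _ => v) measurable_const measurable_const
      measurable_const (measurable_pi_lambda _ hD) (n + 1)) measurable_const) T

end Measurability

end Dynamics

/-! ### Lack of memory for independent exponential lifetimes. -/

section Exponential

variable {Ω : Type*} {mΩ : MeasurableSpace Ω} {P : Measure Ω}

/-- Events determined by disjoint subfamilies of an independent family are independent. -/
lemma measureReal_inter_of_disjoint {ι : Type*} {D : ι → Ω → ℝ} (hD : ∀ l, Measurable (D l))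
    (hind : iIndepFun D P) {S T : Set ι} (hST : Disjoint S T) {A B : Set Ω}
    (hA : MeasurableSet[⨆ i ∈ S, MeasurableSpace.comap (D i) inferInstance] A)
    (hB : MeasurableSet[⨆ i ∈ T, MeasurableSpace.comap (D i) inferInstance] B) :
    P.real (A ∩ B) = P.real A * P.real B := by
  have h := indep_iSup_of_disjoint (fun i => (hD i).comap_le) hind.iIndep hST
  have h' := (Indep_iff _ _ P).1 h A B hA hB
  rw [measureReal_def, h', ENNReal.toReal_mul]
  rfl

lemma measurable_iSup_comap {ι : Type*} {D : ι → Ω → ℝ} {S : Set ι} {i : ι} (hi : i ∈ S) :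
    Measurable[⨆ i ∈ S, MeasurableSpace.comap (D i) inferInstance] (D i) :=
  (comap_measurable (D i)).mono (le_biSup (fun i => MeasurableSpace.comap (D i) inferInstance) hi)
    le_rfl

variable [IsProbabilityMeasure P] {ι : Type*} {D : ι → Ω → ℝ} {μ : ℝ}

/-- Lack of memory of independent exponential lifetimes, for the event that the set of survivors
of a further time `h` is `T'`. -/
lemma measureReal_survivors_eq (hD : ∀ l, Measurable (D l)) (hind : iIndepFun D P)
    (hexp : ∀ l, ∀ a, 0 ≤ a → P.real {ω | a ≤ D l ω} = Real.exp (-(μ * a)))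
    {T T' : Finset ι} (hT' : T' ⊆ T) {a : ι → ℝ} (ha : ∀ l ∈ T, 0 ≤ a l) {h : ℝ} (hh : 0 ≤ h) :
    P.real {ω | (∀ l ∈ T, a l ≤ D l ω) ∧ T.filter (fun l => a l + h ≤ D l ω) = T'} =
      P.real {ω | ∀ l ∈ T, a l ≤ D l ω} *
        (Real.exp (-(μ * h)) ^ T'.card * (1 - Real.exp (-(μ * h))) ^ (T.card - T'.card)) := by
  classical
  have h1 : {ω | (∀ l ∈ T, a l ≤ D l ω) ∧ T.filter (fun l => a l + h ≤ D l ω) = T'} =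
      -- The event is a product event: a survivor has lifetime at least a + h, and a job that leaves
      -- has lifetime in [a, a + h). Each factor is exp(-μa) times exp(-μh) or 1 - exp(-μh).
      ⋂ l ∈ T, D l ⁻¹' (if l ∈ T' then Set.Ici (a l + h) else Set.Ico (a l) (a l + h)) := by
    ext ω
    simp only [Set.mem_ofPred_eq, Set.mem_iInter, Set.mem_preimage, Finset.ext_iff,
      Finset.mem_filter]
    constructor
    · rintro ⟨hω, hω'⟩ l hl
      have := hω' l
      split_ifs with hlT
      · exact (this.2 hlT).2
      · refine ⟨hω l hl, not_le.1 fun hc => hlT (this.1 ⟨hl, hc⟩)⟩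
    · intro hω
      refine ⟨fun l hl => ?_, fun l => ⟨fun hl => ?_, fun hl => ⟨hT' hl, ?_⟩⟩⟩
      · have := hω l hl
        split_ifs at this
        · exact (le_add_of_nonneg_right hh).trans this
        · exact this.1
      · by_contra hc
        have := hω l hl.1
        rw [if_neg hc] at this
        exact not_lt.2 hl.2 this.2
      · have := hω l (hT' hl)
        rwa [if_pos hl] at this
  have h2 : {ω | ∀ l ∈ T, a l ≤ D l ω} = ⋂ l ∈ T, D l ⁻¹' Set.Ici (a l) := by
    ext ω
    simp
  have hfac : ∀ l ∈ T, P.real (D l ⁻¹' (if l ∈ T' then Set.Ici (a l + h)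
      else Set.Ico (a l) (a l + h))) = P.real (D l ⁻¹' Set.Ici (a l)) *
        (if l ∈ T' then Real.exp (-(μ * h)) else 1 - Real.exp (-(μ * h))) := by
    intro l hl
    have e1 : P.real (D l ⁻¹' Set.Ici (a l)) = Real.exp (-(μ * a l)) := hexp l _ (ha l hl)
    have e2 : P.real (D l ⁻¹' Set.Ici (a l + h)) =
        Real.exp (-(μ * a l)) * Real.exp (-(μ * h)) := by
      rw [← Real.exp_add, ← neg_add, ← mul_add]
      exact hexp l _ (add_nonneg (ha l hl) hh)
    split_ifs
    · rw [e1, e2]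
    · have e3 : D l ⁻¹' Set.Ico (a l) (a l + h) =
          (D l ⁻¹' Set.Ici (a l)) \ (D l ⁻¹' Set.Ici (a l + h)) := by
        ext ω
        simp [Set.mem_Ico]
      rw [e3, measureReal_sdiff (Set.preimage_mono (Set.Ici_subset_Ici.2
        (le_add_of_nonneg_right hh))) (hD l measurableSet_Ici), e1, e2]
      ring
  have hcard : ∏ l ∈ T, (if l ∈ T' then Real.exp (-(μ * h)) else 1 - Real.exp (-(μ * h))) =
      Real.exp (-(μ * h)) ^ T'.card * (1 - Real.exp (-(μ * h))) ^ (T.card - T'.card) := by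
    rw [Finset.prod_ite, Finset.prod_const, Finset.prod_const, Finset.filter_mem_eq_inter,
      Finset.inter_eq_right.2 hT', Finset.filter_notMem_eq_sdiff, Finset.card_sdiff_of_subset hT']
  rw [h1, h2, measureReal_def, measureReal_def, hind.meas_biInter, hind.meas_biInter,
    ENNReal.toReal_prod, ENNReal.toReal_prod, ← hcard, ← Finset.prod_mul_distrib]
  · exact Finset.prod_congr rfl hfac
  · exact fun l _ => ⟨_, measurableSet_Ici, rfl⟩
  · intro l _
    split_ifs
    · exact ⟨_, measurableSet_Ici, rfl⟩
    · exact ⟨_, measurableSet_Ico, rfl⟩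

end Exponential

/-! ### The transition law for frozen interarrival times and valuations. -/

section Conditioning

variable {Ω : Type*} {mΩ : MeasurableSpace Ω} {P : Measure Ω} [IsProbabilityMeasure P]
  {D : ℕ ⊕ ℕ → Ω → ℝ} {μ : ℝ} {K : ℕ} {p : ℝ} {x₀ : ℕ} {u v : ℕ → ℝ}

lemma served_subset (d : ℕ ⊕ ℕ → ℝ) (n : ℕ) : served K p x₀ u v d n ⊆
    (Finset.range x₀).disjSum (Finset.range (n + 1)) := by
  intro l hl
  rcases l with i | m
  · simpa using (inl_mem_present.1 hl).1
  · simpa using lt_of_mem_admittedJobs (inr_mem_present.1 hl).1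

lemma startTime_le (hu : ∀ i, 0 ≤ u i) {d : ℕ ⊕ ℕ → ℝ} {n : ℕ} {l : ℕ ⊕ ℕ}
    (hl : l ∈ served K p x₀ u v d n) : startTime u l ≤ arrivalTime u n := by
  have := served_subset d n hl
  rcases l with i | m
  · exact arrivalTime_nonneg hu
  · exact monotone_arrivalTime hu (by simpa [Nat.lt_succ_iff] using this)

/-- Given the jobs in service after the decision on job `n`, the number of busy servers found by
job `n + 1` is binomial. -/
lemma measureReal_served_and_busyCount (hD : ∀ l, Measurable (D l)) (hind : iIndepFun D P)
    (hexp : ∀ l, ∀ a, 0 ≤ a → P.real {ω | a ≤ D l ω} = Real.exp (-(μ * a)))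
    (hu : ∀ i, 0 ≤ u i) (n j : ℕ) (T : Finset (ℕ ⊕ ℕ)) :
    P.real {ω | served K p x₀ u v (fun l => D l ω) n = T ∧
        busyCount K p x₀ u v (fun l => D l ω) (n + 1) = j} =
      P.real {ω | served K p x₀ u v (fun l => D l ω) n = T} *
        binomialWeight T.card j (Real.exp (-(μ * u (n + 1)))) := by
  classical
  -- If T is never the set of jobs in service, both sides vanish. Otherwise a witness shows that all
  -- jobs of T have started, so their ages `a` are nonnegative.
  by_cases hne : ∃ ω, served K p x₀ u v (fun l => D l ω) n = T
  swap
  · simp only [not_exists] at hne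
    simp [hne]
  obtain ⟨ω₀, hω₀⟩ := hne
  set a : ℕ ⊕ ℕ → ℝ := fun l => arrivalTime u n - startTime u l with ha
  have ha0 : ∀ l ∈ T, 0 ≤ a l := fun l hl => sub_nonneg.2 (startTime_le hu (hω₀ ▸ hl))
  -- Replacing each lifetime in T by the age of the job at the arrival of job n makes the event
  -- depend only on lifetimes outside T. The replacement is harmless on `alive`, since `served` does
  -- not see by how much a lifetime exceeds the age.
  set G : Set Ω := {ω | served K p x₀ u v (fun l => if l ∈ T then a l else D l ω) n = T} with hG
  set alive : Set Ω := {ω | ∀ l ∈ T, a l ≤ D l ω} with halive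
  have hE : {ω | served K p x₀ u v (fun l => D l ω) n = T} = G ∩ alive := by
    have key : ∀ ω ∈ alive, served K p x₀ u v (fun l => D l ω) n =
        served K p x₀ u v (fun l => if l ∈ T then a l else D l ω) n := by
      intro ω hω
      refine served_congr hu fun l => ?_
      by_cases hl : l ∈ T
      · have := hω l hl
        simp only [ha] at this
        refine Or.inr ⟨by linarith, ?_⟩
        simp [hl, ha]
      · simp [hl]
    ext ω
    constructor
    · intro hω
      have hω' : ω ∈ alive := by
        intro l hl
        rw [← show served K p x₀ u v (fun l => D l ω) n = T from hω] at hl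
        have := (Finset.mem_filter.1 hl).2
        simp only [ha]
        linarith
      exact ⟨(key ω hω').symm.trans hω, hω'⟩
    · rintro ⟨hω, hω'⟩
      exact (key ω hω').trans hω
  have hGm : MeasurableSet[⨆ i ∈ (T : Set (ℕ ⊕ ℕ))ᶜ,
      MeasurableSpace.comap (D i) inferInstance] G := by
    refine measurableSet_served_eq
      (mα := ⨆ i ∈ (T : Set (ℕ ⊕ ℕ))ᶜ, MeasurableSpace.comap (D i) inferInstance)
      (D := fun ω l => if l ∈ T then a l else D l ω) (fun l => ?_) n T
    by_cases hl : l ∈ T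
    · simpa only [hl, if_true] using measurable_const
    · simpa only [hl, if_false] using measurable_iSup_comap (D := D)
        (S := (T : Set (ℕ ⊕ ℕ))ᶜ) (by simpa using hl)
  have hindep : ∀ B : Set Ω, MeasurableSet[⨆ i ∈ (T : Set (ℕ ⊕ ℕ)),
      MeasurableSpace.comap (D i) inferInstance] B → P.real (G ∩ B) = P.real G * P.real B :=
    fun B hB => measureReal_inter_of_disjoint hD hind disjoint_compl_left hGm hB
  have hDT : ∀ l ∈ T, ∀ c : ℝ, MeasurableSet[⨆ i ∈ (T : Set (ℕ ⊕ ℕ)),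
      MeasurableSpace.comap (D i) inferInstance] {ω | c ≤ D l ω} := fun l hl c =>
    measurable_iSup_comap (D := D) (S := (T : Set (ℕ ⊕ ℕ))) (Finset.mem_coe.2 hl)
      measurableSet_Ici
  have halivem : MeasurableSet[⨆ i ∈ (T : Set (ℕ ⊕ ℕ)),
      MeasurableSpace.comap (D i) inferInstance] alive := by
    have : alive = ⋂ l ∈ T, {ω | a l ≤ D l ω} := by
      ext ω
      simp [halive]
    rw [this]
    exact Finset.measurableSet_biInter T fun l hl => hDT l hl _
  set h := u (n + 1) with hh
  set B : Finset (ℕ ⊕ ℕ) → Set Ω := fun T' =>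
    {ω | (∀ l ∈ T, a l ≤ D l ω) ∧ T.filter (fun l => a l + h ≤ D l ω) = T'} with hB
  have hBm : ∀ T', MeasurableSet[⨆ i ∈ (T : Set (ℕ ⊕ ℕ)),
      MeasurableSpace.comap (D i) inferInstance] (B T') := by
    intro T'
    refine MeasurableSet.inter halivem (measurableSet_finset_eq
      (F := fun ω => T.filter (fun l => a l + h ≤ D l ω)) (fun l => ?_) T')
    simp only [Finset.mem_filter]
    by_cases hl : l ∈ T
    · simpa only [hl, true_and] using hDT l hl _
    · simp [hl]
  have hle : (⨆ i ∈ (T : Set (ℕ ⊕ ℕ)), MeasurableSpace.comap (D i) inferInstance) ≤ mΩ :=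
    iSup₂_le fun i _ => (hD i).comap_le
  -- The jobs of T surviving the further time `h` form some subset of size j. `B T'` concerns only
  -- lifetimes in T, so it is independent of `G`, and all subsets of size j have the same weight.
  have hsplit : {ω | served K p x₀ u v (fun l => D l ω) n = T ∧
      busyCount K p x₀ u v (fun l => D l ω) (n + 1) = j} =
      G ∩ ⋃ T' ∈ Finset.powersetCard j T, B T' := by
    have h1 : ∀ ω, served K p x₀ u v (fun l => D l ω) n = T →
        busyCount K p x₀ u v (fun l => D l ω) (n + 1) =
          (T.filter (fun l => a l + h ≤ D l ω)).card := by
      intro ω hω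
      rw [busyCount_succ hu, hω]
      congr 1
      refine Finset.filter_congr fun l _ => ?_
      rw [arrivalTime_succ, ← hh]
      simp only [ha]
      constructor <;> intro h' <;> linarith
    ext ω
    simp only [Set.mem_ofPred_eq, Set.mem_inter_iff, Set.mem_iUnion, Finset.mem_powersetCard,
      exists_prop]
    constructor
    · rintro ⟨hω, hω'⟩
      have hmem : ω ∈ G ∩ alive := hE ▸ hω
      refine ⟨hmem.1, _, ⟨Finset.filter_subset _ _, ?_⟩, hmem.2, rfl⟩
      rw [← h1 ω hω, hω']
    · rintro ⟨hωG, T', ⟨_, hT'⟩, hω, hω'⟩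
      have hs : ω ∈ {ω | served K p x₀ u v (fun l => D l ω) n = T} := hE ▸ ⟨hωG, hω⟩
      refine ⟨hs, ?_⟩
      rw [h1 ω hs, hω', hT']
  rw [hsplit, hE, hindep _ (Finset.measurableSet_biUnion _ fun T' _ => hBm T'),
    hindep _ halivem, measureReal_biUnion_finset]
  · rw [Finset.sum_congr rfl fun T' hT' => (measureReal_survivors_eq hD hind hexp
      (Finset.mem_powersetCard.1 hT').1 ha0 (hu (n + 1))).trans
        (by rw [(Finset.mem_powersetCard.1 hT').2]), Finset.sum_const, Finset.card_powersetCard,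
      nsmul_eq_mul, binomialWeight]
    ring
  · intro T₁ _ T₂ _ hne
    refine Set.disjoint_left.2 fun ω h₁ h₂ => hne ?_
    exact h₁.2.symm.trans h₂.2
  · exact fun T' _ => hle _ (hBm T')

/-- For given interarrival times and valuations, the number of busy servers found by job `n + 1`
is a binomial thinning of the number of busy servers after the decision on job `n`. -/
lemma measureReal_busyCount_succ (hD : ∀ l, Measurable (D l)) (hind : iIndepFun D P)
    (hexp : ∀ l, ∀ a, 0 ≤ a → P.real {ω | a ≤ D l ω} = Real.exp (-(μ * a)))
    (hu : ∀ i, 0 ≤ u i) (n j : ℕ) :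
    P.real {ω | busyCount K p x₀ u v (fun l => D l ω) (n + 1) = j} =
      ∫ ω, binomialWeight (served K p x₀ u v (fun l => D l ω) n).card j
        (Real.exp (-(μ * u (n + 1)))) ∂P := by
  classical
  -- `Λ` is a finite set containing every possible value of `served`, so the law of total
  -- probability is a finite sum.
  set Λ := ((Finset.range x₀).disjSum (Finset.range (n + 1))).powerset with hΛ
  have hmem : ∀ ω, served K p x₀ u v (fun l => D l ω) n ∈ Λ := fun ω =>
    Finset.mem_powerset.2 (served_subset _ _)
  have hDm : Measurable fun ω l => D l ω := measurable_pi_lambda _ hD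
  have hS : ∀ T, MeasurableSet {ω | served K p x₀ u v (fun l => D l ω) n = T} := fun T =>
    measurableSet_served_eq (D := fun ω l => D l ω) hD n T
  have hZ : MeasurableSet {ω | busyCount K p x₀ u v (fun l => D l ω) (n + 1) = j} :=
    (measurable_busyCount (X := fun _ => x₀) (U := fun _ => u) (V := fun _ => v)
      measurable_const measurable_const measurable_const hDm (n + 1)) (measurableSet_singleton j)
  have h1 : {ω | busyCount K p x₀ u v (fun l => D l ω) (n + 1) = j} =
      ⋃ T ∈ Λ, {ω | served K p x₀ u v (fun l => D l ω) n = T ∧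
        busyCount K p x₀ u v (fun l => D l ω) (n + 1) = j} := by
    ext ω
    simp [hmem ω]
  have h2 : ∀ ω, binomialWeight (served K p x₀ u v (fun l => D l ω) n).card j
      (Real.exp (-(μ * u (n + 1)))) = ∑ T ∈ Λ,
        Set.indicator {ω | served K p x₀ u v (fun l => D l ω) n = T}
          (fun _ => binomialWeight T.card j (Real.exp (-(μ * u (n + 1))))) ω := by
    intro ω
    simp only [Set.indicator_apply, Set.mem_ofPred_eq]
    rw [Finset.sum_ite_eq, if_pos (hmem ω)]
  simp_rw [h2]
  rw [integral_finsetSum _ fun T _ => (integrable_const _).indicator (hS T), h1,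
    measureReal_biUnion_finset]
  · refine Finset.sum_congr rfl fun T _ => ?_
    rw [measureReal_served_and_busyCount hD hind hexp hu, integral_indicator_const _ (hS T),
      smul_eq_mul]
  · intro T₁ _ T₂ _ hne
    refine Set.disjoint_left.2 fun ω h₁ h₂ => hne ?_
    exact h₁.1.symm.trans h₂.1
  · exact fun T _ => (hS T).inter hZ

end Conditioning

attribute [irreducible] busyCount served

/-! ### Fubini's theorem and splitting of independent families. -/

section Independence

variable {Ω : Type*} {mΩ : MeasurableSpace Ω} {P : Measure Ω} [IsProbabilityMeasure P]

/-- Fubini's theorem for independent random variables. -/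
lemma _root_.ProbabilityTheory.IndepFun.integral_comp_eq {α β : Type*} [MeasurableSpace α]
    [MeasurableSpace β] {W : Ω → α} {Y : Ω → β} (h : IndepFun W Y P) (hW : Measurable W)
    (hY : Measurable Y) {F : α → β → ℝ} (hF : Measurable (Function.uncurry F))
    (hint : Integrable (fun ω => F (W ω) (Y ω)) P) :
    ∫ ω, F (W ω) (Y ω) ∂P = ∫ ω, ∫ ω', F (W ω) (Y ω') ∂P ∂P := by
  have hWY : Measurable fun ω => (W ω, Y ω) := hW.prodMk hY
  have hmap := (indepFun_iff_map_prod_eq_prod_map_map hW.aemeasurable hY.aemeasurable).1 h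
  have := Measure.isProbabilityMeasure_map (μ := P) hW.aemeasurable
  have := Measure.isProbabilityMeasure_map (μ := P) hY.aemeasurable
  have hint' : Integrable (Function.uncurry F) ((P.map W).prod (P.map Y)) := by
    rw [← hmap, integrable_map_measure hF.aestronglyMeasurable hWY.aemeasurable]
    exact hint
  calc ∫ ω, F (W ω) (Y ω) ∂P = ∫ z, Function.uncurry F z ∂(P.map fun ω => (W ω, Y ω)) := by
        rw [integral_map hWY.aemeasurable hF.aestronglyMeasurable]
        rfl
    _ = ∫ w, ∫ y, F w y ∂(P.map Y) ∂(P.map W) := by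
        rw [hmap, integral_prod _ hint']
        rfl
    _ = ∫ ω, ∫ y, F (W ω) y ∂(P.map Y) ∂P :=
        integral_map hW.aemeasurable
          (hF.stronglyMeasurable.integral_prod_right (ν := P.map Y)).aestronglyMeasurable
    _ = ∫ ω, ∫ ω', F (W ω) (Y ω') ∂P ∂P := by
        congr 1
        ext ω
        exact integral_map hY.aemeasurable
          (hF.comp measurable_prodMk_left).aestronglyMeasurable

/-- Both hypotheses together say that the joint law is a triple product; reassociating the product
measure moves the bracket. -/
lemma _root_.ProbabilityTheory.IndepFun.prodMk_of_prodMk {α β γ : Type*} [MeasurableSpace α]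
    [MeasurableSpace β] [MeasurableSpace γ] {X : Ω → α} {Y : Ω → β} {Z : Ω → γ}
    (hX : Measurable X) (hY : Measurable Y) (hZ : Measurable Z)
    (h : IndepFun X (fun ω => (Y ω, Z ω)) P) (h' : IndepFun Y Z P) :
    IndepFun (fun ω => (X ω, Y ω)) Z P := by
  have hXY : IndepFun X Y P := h.comp measurable_id measurable_fst
  have := Measure.isProbabilityMeasure_map (μ := P) hX.aemeasurable
  have := Measure.isProbabilityMeasure_map (μ := P) hY.aemeasurable
  have := Measure.isProbabilityMeasure_map (μ := P) hZ.aemeasurable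
  rw [indepFun_iff_map_prod_eq_prod_map_map hX.aemeasurable (hY.prodMk hZ).aemeasurable] at h
  rw [indepFun_iff_map_prod_eq_prod_map_map hY.aemeasurable hZ.aemeasurable] at h'
  rw [indepFun_iff_map_prod_eq_prod_map_map hX.aemeasurable hY.aemeasurable] at hXY
  rw [indepFun_iff_map_prod_eq_prod_map_map (hX.prodMk hY).aemeasurable hZ.aemeasurable, hXY]
  have e : (fun ω => ((X ω, Y ω), Z ω)) =
      MeasurableEquiv.prodAssoc.symm ∘ fun ω => (X ω, (Y ω, Z ω)) := rfl
  rw [e, ← Measure.map_map MeasurableEquiv.prodAssoc.symm.measurable (hX.prodMk (hY.prodMk hZ)),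
    h, h', ← Measure.prodAssoc_prod, Measure.map_map MeasurableEquiv.prodAssoc.symm.measurable
      MeasurableEquiv.prodAssoc.measurable]
  simp

/-- A subfamily is encoded by setting the other coordinates to 0, so that all subfamilies take
values in one function space. Only the selected coordinates need be measurable, which matters for
the sub-σ-algebra they generate. -/
lemma measurable_indicator_pi {ι : Type*} {m : MeasurableSpace Ω} {ξ : ι → Ω → ℝ} {A : Set ι}
    (h : ∀ i ∈ A, Measurable (ξ i)) : Measurable fun ω => A.indicator fun i => ξ i ω := by
  refine measurable_pi_lambda _ fun i => ?_
  by_cases hi : i ∈ A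
  · simpa only [Set.indicator_of_mem hi] using h i hi
  · simpa only [Set.indicator_of_notMem hi] using measurable_const

/-- If `X` is independent of an independent family, then it is independent of a part of the
family jointly with the rest. -/
lemma indepFun_prodMk_indicator {ι α : Type*} [MeasurableSpace α] {X : Ω → α} {ξ : ι → Ω → ℝ}
    (hX : Measurable X) (hξ : ∀ i, Measurable (ξ i)) (hind : iIndepFun ξ P)
    (hind₀ : IndepFun X (fun ω i => ξ i ω) P) (A : Set ι) :
    IndepFun (fun ω => (X ω, A.indicator fun i => ξ i ω)) (fun ω => Aᶜ.indicator fun i => ξ i ω)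
      P := by
  refine IndepFun.prodMk_of_prodMk hX (measurable_indicator_pi fun i _ => hξ i)
    (measurable_indicator_pi fun i _ => hξ i) ?_ ?_
  · exact hind₀.comp measurable_id (ψ := fun f => (A.indicator f, Aᶜ.indicator f))
      ((measurable_indicator_pi (ξ := fun i (f : ι → ℝ) => f i)
        fun i _ => measurable_pi_apply i).prodMk
        (measurable_indicator_pi (ξ := fun i (f : ι → ℝ) => f i)
          fun i _ => measurable_pi_apply i))
  · have h := indep_iSup_of_disjoint (fun i => (hξ i).comap_le) hind.iIndep
      (disjoint_compl_right (a := A))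
    rw [IndepFun_iff_Indep]
    exact indep_of_indep_of_le_left (indep_of_indep_of_le_right h
      (measurable_indicator_pi fun i hi => measurable_iSup_comap hi).comap_le)
      (measurable_indicator_pi fun i hi => measurable_iSup_comap hi).comap_le

end Independence

/-! ### The random model and its one-step transition law. -/

/-- The primitives of the loss system: the initial number of busy servers `X₀`, the joint family
`D` of the remaining service times of the initial jobs and of the service times, the interarrival
times `U` and the valuations `V`. -/
structure IsModel {Ω : Type*} {mΩ : MeasurableSpace Ω} (P : Measure Ω) (K : ℕ) (μ : ℝ)
    (X₀ : Ω → ℕ) (D : ℕ ⊕ ℕ → Ω → ℝ) (U V : ℕ → Ω → ℝ) : Prop where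
  rate_pos : 0 < μ
  measurable_init : Measurable X₀
  init_le : ∀ ω, X₀ ω ≤ K
  measurable_service : ∀ l, Measurable (D l)
  service_nonneg : ∀ l ω, 0 ≤ D l ω
  survival : ∀ l a, 0 ≤ a → P.real {ω | a ≤ D l ω} = Real.exp (-(μ * a))
  measurable_interarrival : ∀ n, Measurable (U n)
  interarrival_nonneg : ∀ n ω, 0 ≤ U n ω
  identDistrib_interarrival : ∀ n, IdentDistrib (U n) (U 0) P P
  measurable_valuation : ∀ n, Measurable (V n)
  identDistrib_valuation : ∀ n, IdentDistrib (V n) (V 0) P P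
  indep : iIndepFun (Sum.elim D (Sum.elim U V)) P
  indep_init : IndepFun X₀ (fun ω i => Sum.elim D (Sum.elim U V) i ω) P

/-- The probability that exactly `j` of `y` jobs in service are still in service after an
interarrival time distributed as `T`. -/
noncomputable def survivalWeight {Ω : Type*} {mΩ : MeasurableSpace Ω} (P : Measure Ω) (μ : ℝ)
    (T : Ω → ℝ) (y j : ℕ) : ℝ :=
  ∫ ω, binomialWeight y j (Real.exp (-(μ * T ω))) ∂P

lemma measurable_binomialWeight (j : ℕ) :
    Measurable fun z : ℕ × ℝ => binomialWeight z.1 j z.2 :=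
  measurable_from_prod_countable_right fun y => by
    unfold binomialWeight
    fun_prop

lemma measurable_afterDecision (K : ℕ) (p : ℝ) :
    Measurable fun z : ℕ × ℝ => afterDecision K p z.1 z.2 := by
  refine measurable_from_prod_countable_right fun i => ?_
  by_cases hi : i < K
  · simp only [afterDecision, hi, true_and]
    exact Measurable.ite measurableSet_Ici measurable_const measurable_const
  · simpa only [afterDecision, hi, false_and, if_false] using measurable_const

namespace IsModel

variable {Ω : Type*} {mΩ : MeasurableSpace Ω} {P : Measure Ω}
  {K : ℕ} {μ : ℝ} {X₀ : Ω → ℕ} {D : ℕ ⊕ ℕ → Ω → ℝ} {U V : ℕ → Ω → ℝ}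

/-- The number of busy servers found by job `n`. -/
noncomputable def busy (K : ℕ) (X₀ : Ω → ℕ) (D : ℕ ⊕ ℕ → Ω → ℝ) (U V : ℕ → Ω → ℝ) (p : ℝ)
    (n : ℕ) (ω : Ω) : ℕ :=
  busyCount K p (X₀ ω) (fun i => U i ω) (fun i => V i ω) (fun l => D l ω) n

lemma measurable_family (h : IsModel P K μ X₀ D U V) (i : (ℕ ⊕ ℕ) ⊕ (ℕ ⊕ ℕ)) :
    Measurable (Sum.elim D (Sum.elim U V) i) := by
  rcases i with l | n | n
  · exact h.measurable_service l
  · exact h.measurable_interarrival n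
  · exact h.measurable_valuation n

lemma measurable_busy (h : IsModel P K μ X₀ D U V) (p : ℝ) (n : ℕ) :
    Measurable (busy K X₀ D U V p n) :=
  measurable_busyCount h.measurable_init (measurable_pi_lambda _ h.measurable_interarrival)
    (measurable_pi_lambda _ h.measurable_valuation) (measurable_pi_lambda _ h.measurable_service) n

lemma busy_le (h : IsModel P K μ X₀ D U V) (p : ℝ) (n : ℕ) (ω : Ω) :
    busy K X₀ D U V p n ω ≤ K :=
  busyCount_le (fun i => h.interarrival_nonneg i ω) (fun l => h.service_nonneg l ω) (h.init_le ω) n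

lemma exp_interarrival_le_one (h : IsModel P K μ X₀ D U V) (n : ℕ) (ω : Ω) :
    Real.exp (-(μ * U n ω)) ≤ 1 :=
  Real.exp_le_one_iff.2 (neg_nonpos.2 (mul_nonneg h.rate_pos.le (h.interarrival_nonneg n ω)))

lemma survivalWeight_eq (h : IsModel P K μ X₀ D U V) (n y j : ℕ) :
    survivalWeight P μ (U n) y j = survivalWeight P μ (U 0) y j := by
  have hm : Measurable fun t : ℝ => binomialWeight y j (Real.exp (-(μ * t))) :=
    (measurable_binomialWeight j).comp (measurable_const.prodMk (by fun_prop))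
  exact ((h.identDistrib_interarrival n).comp hm).integral_eq

lemma survivalWeight_nonneg (h : IsModel P K μ X₀ D U V) (n y j : ℕ) :
    0 ≤ survivalWeight P μ (U n) y j :=
  integral_nonneg fun ω =>
    binomialWeight_nonneg (Real.exp_nonneg _) (h.exp_interarrival_le_one n ω) _ _

variable [IsProbabilityMeasure P]

lemma integrable_binomialWeight (h : IsModel P K μ X₀ D U V) {Y : Ω → ℕ} (hY : Measurable Y)
    (n j : ℕ) : Integrable (fun ω => binomialWeight (Y ω) j (Real.exp (-(μ * U n ω)))) P := by
  have hU := h.measurable_interarrival n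
  refine Integrable.of_bound (C := 1) ((measurable_binomialWeight j).comp
    (hY.prodMk (by fun_prop : Measurable fun ω => Real.exp (-(μ * U n ω))))).aestronglyMeasurable
    (Eventually.of_forall fun ω => ?_)
  rw [Real.norm_of_nonneg (binomialWeight_nonneg (Real.exp_nonneg _)
    (h.exp_interarrival_le_one n ω) _ _)]
  exact binomialWeight_le_one (Real.exp_nonneg _) (h.exp_interarrival_le_one n ω) _ _

lemma indepFun_init_indicator (h : IsModel P K μ X₀ D U V) (A : Set ((ℕ ⊕ ℕ) ⊕ (ℕ ⊕ ℕ))) :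
    IndepFun (fun ω => (X₀ ω, A.indicator fun i => Sum.elim D (Sum.elim U V) i ω))
      (fun ω => Aᶜ.indicator fun i => Sum.elim D (Sum.elim U V) i ω) P :=
  indepFun_prodMk_indicator h.measurable_init h.measurable_family h.indep h.indep_init A

/-- The initial state, the interarrival times and the valuations are jointly independent of the
service times. -/
lemma indepFun_service (h : IsModel P K μ X₀ D U V) :
    IndepFun (fun ω => (X₀ ω, (fun i => U i ω : ℕ → ℝ), (fun i => V i ω : ℕ → ℝ)))
      (fun ω l => D l ω) P := by
  -- The selected part consists of all interarrival times and valuations; its complement is the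
  -- family of service times.
  have hi := (h.indepFun_init_indicator (Set.range Sum.inr)).comp
    (φ := fun z => (z.1, (fun i => z.2 (.inr (.inl i)) : ℕ → ℝ),
      (fun i => z.2 (.inr (.inr i)) : ℕ → ℝ))) (ψ := fun z l => z (.inl l))
    (by fun_prop) (by fun_prop)
  convert hi using 1 <;> ext ω <;> simp [Set.indicator]

lemma measureReal_busy_succ_eq_integral (h : IsModel P K μ X₀ D U V) (p : ℝ) (n j : ℕ) :
    P.real {ω | busy K X₀ D U V p (n + 1) ω = j} =
      ∫ ω, binomialWeight (afterDecision K p (busy K X₀ D U V p n ω) (V n ω)) j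
        (Real.exp (-(μ * U (n + 1) ω))) ∂P := by
  set W : Ω → ℕ × (ℕ → ℝ) × (ℕ → ℝ) := fun ω => (X₀ ω, fun i => U i ω, fun i => V i ω) with hW
  set Y : Ω → ℕ ⊕ ℕ → ℝ := fun ω l => D l ω with hY
  have hWm : Measurable W := h.measurable_init.prodMk
    ((measurable_pi_lambda _ h.measurable_interarrival).prodMk
      (measurable_pi_lambda _ h.measurable_valuation))
  have hYm : Measurable Y := measurable_pi_lambda _ h.measurable_service
  have hind : IndepFun W Y P := h.indepFun_service
  set S : Set ((ℕ × (ℕ → ℝ) × (ℕ → ℝ)) × (ℕ ⊕ ℕ → ℝ)) :=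
    {z | busyCount K p z.1.1 z.1.2.1 z.1.2.2 z.2 (n + 1) = j} with hS
  have hSm : MeasurableSet S :=
    measurable_busyCount (X := fun z : (ℕ × (ℕ → ℝ) × (ℕ → ℝ)) × (ℕ ⊕ ℕ → ℝ) => z.1.1)
      (U := fun z => z.1.2.1) (V := fun z => z.1.2.2) (D := fun z => z.2) (by fun_prop) (by fun_prop) (by fun_prop) (by fun_prop) (n + 1)
      (measurableSet_singleton j)
  set F : ℕ × (ℕ → ℝ) × (ℕ → ℝ) → (ℕ ⊕ ℕ → ℝ) → ℝ := fun w d => S.indicator 1 (w, d) with hF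
  set G : ℕ × (ℕ → ℝ) × (ℕ → ℝ) → (ℕ ⊕ ℕ → ℝ) → ℝ := fun w d =>
    binomialWeight (served K p w.1 w.2.1 w.2.2 d n).card j (Real.exp (-(μ * w.2.1 (n + 1)))) with hG
  have hFm : Measurable (Function.uncurry F) := measurable_one.indicator hSm
  have hGm : Measurable (Function.uncurry G) := by
    refine (measurable_binomialWeight j).comp (Measurable.prodMk
      (measurable_comp_served (X := fun z : (ℕ × (ℕ → ℝ) × (ℕ → ℝ)) × (ℕ ⊕ ℕ → ℝ) => z.1.1)
        (U := fun z => z.1.2.1) (V := fun z => z.1.2.2)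
        (D := fun z => z.2) (by fun_prop) (by fun_prop) (by fun_prop) (by fun_prop) n
        Finset.card) (by fun_prop))
  have hserved : ∀ ω, G (W ω) (Y ω) =
      binomialWeight (afterDecision K p (busy K X₀ D U V p n ω) (V n ω)) j
        (Real.exp (-(μ * U (n + 1) ω))) := by
    intro ω
    simp only [hG, card_served (d := Y ω) (fun l => h.service_nonneg l ω)]
    rfl
  have hbusy : ∀ ω, F (W ω) (Y ω) = {ω | busy K X₀ D U V p (n + 1) ω = j}.indicator 1 ω :=
    fun ω => rfl
  have hbm : MeasurableSet {ω | busy K X₀ D U V p (n + 1) ω = j} :=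
    h.measurable_busy p (n + 1) (measurableSet_singleton j)
  have hdec : Measurable fun ω => afterDecision K p (busy K X₀ D U V p n ω) (V n ω) := by
    have : (fun ω => afterDecision K p (busy K X₀ D U V p n ω) (V n ω)) = fun ω =>
        (served K p (X₀ ω) (fun i => U i ω) (fun i => V i ω) (fun l => D l ω) n).card := by
      ext ω
      rw [card_served (fun l => h.service_nonneg l ω)]
      rfl
    rw [this]
    exact measurable_comp_served h.measurable_init
      (measurable_pi_lambda _ h.measurable_interarrival)
      (measurable_pi_lambda _ h.measurable_valuation) hYm n Finset.card
  -- Fubini is used in both directions: first `W` is frozen and the conditional result for fixed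
  -- paths is applied, then the two integrals are merged again with the binomial weight as
  -- integrand.
  calc P.real {ω | busy K X₀ D U V p (n + 1) ω = j}
      = ∫ ω, F (W ω) (Y ω) ∂P := by
        simp_rw [hbusy]
        rw [integral_indicator_one hbm]
    _ = ∫ ω, ∫ ω', F (W ω) (Y ω') ∂P ∂P := by
        refine hind.integral_comp_eq hWm hYm hFm ?_
        simp_rw [hbusy]
        exact (integrable_const (1 : ℝ)).indicator hbm
    _ = ∫ ω, ∫ ω', G (W ω) (Y ω') ∂P ∂P := by
        congr 1
        ext ω
        have hind' : iIndepFun D P := h.indep.precomp (g := Sum.inl) Sum.inl_injective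
        have := measureReal_busyCount_succ (K := K) (p := p) (x₀ := X₀ ω) (u := fun i => U i ω)
          (v := fun i => V i ω) h.measurable_service hind' h.survival
          (fun i => h.interarrival_nonneg i ω) n j
        rw [← this, ← integral_indicator_one]
        · rfl
        · exact measurable_busyCount (X := fun _ => X₀ ω) (U := fun _ i => U i ω)
            (V := fun _ i => V i ω) measurable_const measurable_const measurable_const hYm (n + 1)
            (measurableSet_singleton j)
    _ = ∫ ω, G (W ω) (Y ω) ∂P := by
        refine (hind.integral_comp_eq hWm hYm hGm ?_).symm
        simp_rw [hserved]
        exact h.integrable_binomialWeight hdec (n + 1) j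
    _ = _ := by simp_rw [hserved]

/-- The number of busy servers found by job `n` is a function of the initial state and of all
primitives except the interarrival times after its arrival and the valuations from job `n` on. -/
lemma busy_eq_of_indicator {A : Set ((ℕ ⊕ ℕ) ⊕ (ℕ ⊕ ℕ))} {n : ℕ} (hD : ∀ l, .inl l ∈ A)
    (hU : ∀ i ≤ n, .inr (.inl i) ∈ A) (hV : ∀ i < n, .inr (.inr i) ∈ A) (p : ℝ) (ω : Ω) :
    busy K X₀ D U V p n ω = busyCount K p (X₀ ω)
      (fun i => A.indicator (fun i => Sum.elim D (Sum.elim U V) i ω) (.inr (.inl i)))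
      (fun i => A.indicator (fun i => Sum.elim D (Sum.elim U V) i ω) (.inr (.inr i)))
      (fun l => A.indicator (fun i => Sum.elim D (Sum.elim U V) i ω) (.inl l)) n := by
  have : (fun l => A.indicator (fun i => Sum.elim D (Sum.elim U V) i ω) (.inl l)) =
      fun l => D l ω := by
    ext l
    rw [Set.indicator_of_mem (hD l)]
    rfl
  rw [this]
  refine busyCount_congr (fun i hi => ?_) (fun i hi => ?_)
  · rw [Set.indicator_of_mem (hU i hi)]
    rfl
  · rw [Set.indicator_of_mem (hV i hi)]
    rfl

lemma measurable_busyCount_pi (p : ℝ) (n : ℕ) :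
    Measurable fun z : ℕ × ((ℕ ⊕ ℕ) ⊕ (ℕ ⊕ ℕ) → ℝ) => busyCount K p z.1
      (fun i => z.2 (.inr (.inl i))) (fun i => z.2 (.inr (.inr i))) (fun l => z.2 (.inl l)) n :=
  measurable_busyCount (by fun_prop) (by fun_prop) (by fun_prop) (by fun_prop) n

/-- The valuation of job n is not consulted before its own decision, so the state it finds is a
function of the initial state and the family with that one coordinate deleted. -/
lemma indepFun_busy_valuation (h : IsModel P K μ X₀ D U V) (p : ℝ) (n : ℕ) :
    IndepFun (busy K X₀ D U V p n) (V n) P := by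
  have hψ : Measurable fun z : (ℕ ⊕ ℕ) ⊕ (ℕ ⊕ ℕ) → ℝ => z (.inr (.inr n)) := measurable_pi_apply _
  have hi := (h.indepFun_init_indicator {.inr (.inr n)}ᶜ).comp
    (measurable_busyCount_pi (K := K) p n) hψ
  convert hi using 1
  · ext ω
    exact busy_eq_of_indicator (by simp) (by simp) (fun i hi => by simpa using hi.ne) p ω
  · ext ω
    simp

/-- `U (n + 1)` affects only arrivals after job n. Together with `indepFun_busy_valuation` this
makes the state, the valuation and the next interarrival time mutually independent. -/
lemma indepFun_busy_interarrival (h : IsModel P K μ X₀ D U V) (p : ℝ) (n : ℕ) :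
    IndepFun (fun ω => (busy K X₀ D U V p n ω, V n ω)) (U (n + 1)) P := by
  have hφ : Measurable fun z : ℕ × ((ℕ ⊕ ℕ) ⊕ (ℕ ⊕ ℕ) → ℝ) => (busyCount K p z.1
      (fun i => z.2 (.inr (.inl i))) (fun i => z.2 (.inr (.inr i))) (fun l => z.2 (.inl l)) n,
        z.2 (.inr (.inr n))) :=
    (measurable_busyCount_pi (K := K) p n).prodMk ((measurable_pi_apply _).comp measurable_snd)
  have hψ : Measurable fun z : (ℕ ⊕ ℕ) ⊕ (ℕ ⊕ ℕ) → ℝ => z (.inr (.inl (n + 1))) :=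
    measurable_pi_apply _
  have hi := (h.indepFun_init_indicator {.inr (.inl (n + 1))}ᶜ).comp hφ hψ
  convert hi using 1
  · ext ω
    · exact busy_eq_of_indicator (by simp) (fun i hi => by simp; omega) (by simp) p ω
    · simp
  · ext ω
    simp

/-- The transform enters here: the k-th power of the survival probability exp(-μU) has mean φ(kμ).
-/
lemma sum_survivalWeight_mul_choose (h : IsModel P K μ X₀ D U V) (n k : ℕ) {y N : ℕ}
    (hy : y ≤ N) : ∑ j ∈ Finset.range (N + 1), survivalWeight P μ (U n) y j * (j.choose k : ℝ) =
      (y.choose k : ℝ) * lst P (U n) (k * μ) := by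
  simp only [survivalWeight, lst]
  simp_rw [← integral_mul_const]
  rw [← integral_finsetSum _ fun j _ =>
    (h.integrable_binomialWeight measurable_const n j).mul_const _, ← integral_const_mul]
  congr 1
  ext ω
  rw [sum_binomialWeight_mul_choose hy, ← Real.exp_nat_mul]
  congr 2
  ring

lemma lst_zero (T : Ω → ℝ) : lst P T 0 = 1 := by
  simp [lst]

lemma sum_survivalWeight (h : IsModel P K μ X₀ D U V) (n : ℕ) {y N : ℕ} (hy : y ≤ N) :
    ∑ j ∈ Finset.range (N + 1), survivalWeight P μ (U n) y j = 1 := by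
  simpa [lst_zero] using h.sum_survivalWeight_mul_choose n 0 hy

lemma abs_survivalWeight_le_one (h : IsModel P K μ X₀ D U V) (n y j : ℕ) :
    |survivalWeight P μ (U n) y j| ≤ 1 := by
  rw [abs_of_nonneg (h.survivalWeight_nonneg n y j), ← h.sum_survivalWeight n (le_max_left y j)]
  exact Finset.single_le_sum (f := fun j => survivalWeight P μ (U n) y j)
    (fun i _ => h.survivalWeight_nonneg n y i)
    (Finset.mem_range.2 (Nat.lt_succ_of_le (le_max_right y j)))

attribute [irreducible] busy afterDecision binomialWeight

/-- The transition probabilities of the number of busy servers found by successive jobs. -/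
lemma measureReal_busy_succ (h : IsModel P K μ X₀ D U V) (p : ℝ) (n j : ℕ) :
    P.real {ω | busy K X₀ D U V p (n + 1) ω = j} =
      ∑ i ∈ Finset.range (K + 1), P.real {ω | busy K X₀ D U V p n ω = i} *
        ∫ ω, survivalWeight P μ (U 0) (afterDecision K p i (V 0 ω)) j ∂P := by
  have hdec := measurable_afterDecision K p
  have hZ := h.measurable_busy p n
  have hV := h.measurable_valuation n
  have hw : Measurable fun z : ℕ × ℝ =>
      survivalWeight P μ (U 0) (afterDecision K p z.1 z.2) j :=
    (measurable_from_top (f := fun y => survivalWeight P μ (U 0) y j)).comp hdec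
  rw [h.measureReal_busy_succ_eq_integral]
  have hF : Measurable fun z : (ℕ × ℝ) × ℝ =>
      binomialWeight (afterDecision K p z.1.1 z.1.2) j (Real.exp (-(μ * z.2))) :=
    (measurable_binomialWeight j).comp ((hdec.comp measurable_fst).prodMk
      (Real.measurable_exp.comp (measurable_snd.const_mul μ).neg))
  have hint : Integrable (fun ω => binomialWeight
      (afterDecision K p (busy K X₀ D U V p n ω) (V n ω)) j (Real.exp (-(μ * U (n + 1) ω)))) P :=
    h.integrable_binomialWeight (hdec.comp (hZ.prodMk hV)) (n + 1) j
  have e1 := (h.indepFun_busy_interarrival p n).integral_comp_eq (hZ.prodMk hV)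
    (h.measurable_interarrival (n + 1))
    (F := fun z t => binomialWeight (afterDecision K p z.1 z.2) j (Real.exp (-(μ * t)))) hF hint
  refine e1.trans ?_
  have e2 : ∀ ω, ∫ ω', binomialWeight (afterDecision K p (busy K X₀ D U V p n ω) (V n ω)) j
      (Real.exp (-(μ * U (n + 1) ω'))) ∂P =
      survivalWeight P μ (U 0) (afterDecision K p (busy K X₀ D U V p n ω) (V n ω)) j :=
    fun ω => h.survivalWeight_eq (n + 1) _ j
  simp_rw [e2]
  refine ((h.indepFun_busy_valuation p n).integral_comp_eq hZ hV
    (F := fun i x => survivalWeight P μ (U 0) (afterDecision K p i x) j) hw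
    (Integrable.of_bound (C := 1) (hw.comp (hZ.prodMk hV)).aestronglyMeasurable
      (Eventually.of_forall fun ω => h.abs_survivalWeight_le_one 0 _ j))).trans ?_
  have e3 : ∀ i, ∫ ω', survivalWeight P μ (U 0) (afterDecision K p i (V n ω')) j ∂P =
      ∫ ω', survivalWeight P μ (U 0) (afterDecision K p i (V 0 ω')) j ∂P := fun i =>
    ((h.identDistrib_valuation n).comp (hw.comp (measurable_prodMk_left (x := i)))).integral_eq
  simp_rw [e3]
  have hs : ∀ i, MeasurableSet {ω | busy K X₀ D U V p n ω = i} := fun i =>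
    hZ (measurableSet_singleton i)
  have e4 : ∀ ω, ∫ ω', survivalWeight P μ (U 0)
      (afterDecision K p (busy K X₀ D U V p n ω) (V 0 ω')) j ∂P =
      ∑ i ∈ Finset.range (K + 1), {ω | busy K X₀ D U V p n ω = i}.indicator (fun _ =>
        ∫ ω', survivalWeight P μ (U 0) (afterDecision K p i (V 0 ω')) j ∂P) ω := by
    intro ω
    simp only [Set.indicator_apply, Set.mem_ofPred_eq]
    rw [Finset.sum_ite_eq, if_pos (Finset.mem_range.2 (Nat.lt_succ_of_le (h.busy_le p n ω)))]
  simp_rw [e4]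
  rw [integral_finsetSum _ fun i _ => (integrable_const _).indicator (hs i)]
  refine Finset.sum_congr rfl fun i _ => ?_
  rw [integral_indicator_const _ (hs i), smul_eq_mul]

lemma integral_afterDecision (h : IsModel P K μ X₀ D U V) (p : ℝ) (i : ℕ) (g : ℕ → ℝ) :
    ∫ ω, g (afterDecision K p i (V 0 ω)) ∂P =
      g i + if i < K then tail P (V 0) p * (g (i + 1) - g i) else 0 := by
  by_cases hi : i < K
  · have hs : MeasurableSet {ω | p ≤ V 0 ω} := h.measurable_valuation 0 measurableSet_Ici
    have e : ∀ ω, g (afterDecision K p i (V 0 ω)) =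
        g i + {ω | p ≤ V 0 ω}.indicator (fun _ => g (i + 1) - g i) ω := by
      intro ω
      by_cases hω : p ≤ V 0 ω <;> simp [afterDecision, hi, hω]
    simp_rw [e]
    rw [integral_add (integrable_const _) ((integrable_const _).indicator hs),
      integral_indicator_const _ hs, if_pos hi]
    simp [tail]
  · simp [afterDecision, hi]

/-! ### Positivity bounds from the nonzero mean. -/

lemma integrable_exp (h : IsModel P K μ X₀ D U V) {s : ℝ} (hs : 0 ≤ s) (n : ℕ) :
    Integrable (fun ω => Real.exp (-(s * U n ω))) P := by
  have hU := h.measurable_interarrival n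
  refine Integrable.of_bound (C := 1) (by fun_prop) (Eventually.of_forall fun ω => ?_)
  rw [Real.norm_of_nonneg (Real.exp_nonneg _)]
  exact Real.exp_le_one_iff.2 (neg_nonpos.2 (mul_nonneg hs (h.interarrival_nonneg n ω)))

lemma lst_pos (h : IsModel P K μ X₀ D U V) {s : ℝ} (hs : 0 ≤ s) (n : ℕ) :
    0 < lst P (U n) s :=
  integral_exp_pos (h.integrable_exp hs n)

/-- If the integral vanished, the nonnegative integrand would be zero a.e., so the interarrival time
would be zero a.e., against the nonzero mean. The case k = K supplies the minorization constant. -/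
lemma integral_one_sub_exp_pow_pos (h : IsModel P K μ X₀ D U V) {s : ℝ} (hs : 0 < s) {n : ℕ}
    (hmean : ∫ ω, U n ω ∂P ≠ 0) (k : ℕ) :
    0 < ∫ ω, (1 - Real.exp (-(s * U n ω))) ^ k ∂P := by
  have hU := h.measurable_interarrival n
  have h0 : ∀ ω, 0 ≤ 1 - Real.exp (-(s * U n ω)) := fun ω => sub_nonneg.2
    (Real.exp_le_one_iff.2 (neg_nonpos.2 (mul_nonneg hs.le (h.interarrival_nonneg n ω))))
  have hnn : ∀ ω, 0 ≤ (1 - Real.exp (-(s * U n ω))) ^ k := fun ω => pow_nonneg (h0 ω) k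
  have hint : Integrable (fun ω => (1 - Real.exp (-(s * U n ω))) ^ k) P := by
    refine Integrable.of_bound (C := 1) (by fun_prop) (Eventually.of_forall fun ω => ?_)
    rw [Real.norm_of_nonneg (hnn ω)]
    exact pow_le_one₀ (h0 ω) (by linarith [Real.exp_nonneg (-(s * U n ω))])
  refine lt_of_le_of_ne (integral_nonneg hnn) fun hzero => hmean ?_
  have hae := (integral_eq_zero_iff_of_nonneg hnn hint).1 hzero.symm
  refine integral_eq_zero_of_ae ?_
  filter_upwards [hae] with ω hω
  have h1 : 1 - Real.exp (-(s * U n ω)) = 0 := eq_zero_of_pow_eq_zero hω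
  have h2 : Real.exp (-(s * U n ω)) = 1 := by linarith
  have h3 : s * U n ω = 0 := by simpa using h2
  exact (mul_eq_zero.1 h3).resolve_left hs.ne'

lemma lst_lt_one (h : IsModel P K μ X₀ D U V) {s : ℝ} (hs : 0 < s) {n : ℕ}
    (hmean : ∫ ω, U n ω ∂P ≠ 0) : lst P (U n) s < 1 := by
  have := h.integral_one_sub_exp_pow_pos hs hmean 1
  simp only [pow_one] at this
  rw [integral_sub (integrable_const _) (h.integrable_exp hs.le n)] at this
  simpa [lst] using this

/-- All y jobs leave with conditional probability (1 - exp(-μU))^y, which decreases in y; the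
largest possible number of jobs gives a bound uniform in the state. -/
lemma le_survivalWeight_zero (h : IsModel P K μ X₀ D U V) (n : ℕ) {y N : ℕ} (hy : y ≤ N) :
    ∫ ω, (1 - Real.exp (-(μ * U n ω))) ^ N ∂P ≤ survivalWeight P μ (U n) y 0 := by
  have hb : ∀ y, ∀ ω, binomialWeight y 0 (Real.exp (-(μ * U n ω))) =
      (1 - Real.exp (-(μ * U n ω))) ^ y := by
    simp [binomialWeight]
  have hi := fun y => h.integrable_binomialWeight (measurable_const (a := y)) n 0
  simp only [hb] at hi
  simp only [survivalWeight, hb]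
  refine integral_mono (hi N) (hi y) fun ω => ?_
  exact pow_le_pow_of_le_one (sub_nonneg.2 (h.exp_interarrival_le_one n ω))
    (by linarith [Real.exp_nonneg (-(μ * U n ω))]) hy

lemma sum_measureReal_busy (h : IsModel P K μ X₀ D U V) (p : ℝ) (n : ℕ) :
    ∑ i ∈ Finset.range (K + 1), P.real {ω | busy K X₀ D U V p n ω = i} = 1 := by
  have hu : (⋃ i ∈ Finset.range (K + 1), {ω | busy K X₀ D U V p n ω = i}) = Set.univ := by
    ext ω
    simpa [Nat.lt_succ_iff] using h.busy_le p n ω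
  rw [← measureReal_biUnion_finset, hu, probReal_univ]
  · intro i _ j _ hij
    exact Set.disjoint_left.2 fun ω h₁ h₂ => hij (h₁.symm.trans h₂)
  · exact fun i _ => h.measurable_busy p n (measurableSet_singleton i)

/-! ### The limit law and its moment recursion. -/

/-- The limiting distribution of the number of busy servers found on arrival exists, and its
binomial moments satisfy a recursion. -/
theorem exists_limit (h : IsModel P K μ X₀ D U V) (hmean : ∫ ω, U 0 ω ∂P ≠ 0) (p : ℝ) :
    ∃ B : ℕ → ℝ, Tendsto (fun n => P.real {ω | busy K X₀ D U V p n ω = K}) atTop (𝓝 (B K)) ∧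
      B 0 = 1 ∧ ∀ k, (1 - lst P (U 0) ((k + 1 : ℕ) * μ)) / lst P (U 0) ((k + 1 : ℕ) * μ) *
        B (k + 1) = tail P (V 0) p * (B k - (K.choose k : ℝ) * B K) := by
  set q := tail P (V 0) p with hq
  set w := survivalWeight P μ (U 0) with hw
  have hq0 : 0 ≤ q := measureReal_nonneg
  have hq1 : q ≤ 1 := measureReal_le_one
  set M : ℕ → ℕ → ℝ := fun i j => w i j + if i < K then q * (w (i + 1) j - w i j) else 0 with hM
  have hMw : ∀ (f : ℕ → ℝ) i, ∑ j ∈ Finset.range (K + 1), M i j * f j =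
      (∑ j ∈ Finset.range (K + 1), w i j * f j) + if i < K then
        q * ((∑ j ∈ Finset.range (K + 1), w (i + 1) j * f j) -
          ∑ j ∈ Finset.range (K + 1), w i j * f j) else 0 := by
    intro f i
    simp only [hM]
    split_ifs
    · rw [← Finset.sum_sub_distrib, Finset.mul_sum, ← Finset.sum_add_distrib]
      exact Finset.sum_congr rfl fun j _ => by ring
    · simp
  have hrec : ∀ n j, P.real {ω | busy K X₀ D U V p (n + 1) ω = j} =
      ∑ i ∈ Finset.range (K + 1), P.real {ω | busy K X₀ D U V p n ω = i} * M i j := by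
    intro n j
    rw [h.measureReal_busy_succ]
    exact Finset.sum_congr rfl fun i _ => by
      rw [h.integral_afterDecision p i fun y => survivalWeight P μ (U 0) y j]
  -- For i < K the entry is the convex combination (1 - q) w_i + q w_{i+1}, and for i = K it is w_K,
  -- so uniform lower bounds on `w` pass to `M`.
  have hlow : ∀ (c : ℝ) (i j : ℕ), i ≤ K → (∀ y ≤ K, c ≤ w y j) → c ≤ M i j := by
    intro c i j hi hc
    simp only [hM]
    split_ifs with hiK
    · nlinarith [hc i hi, hc (i + 1) hiK]
    · linarith [hc i hi]
  obtain ⟨L, hL⟩ := exists_tendsto_of_minorization (K := K) (M := M)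
    (h.integral_one_sub_exp_pow_pos h.rate_pos hmean K)
    (fun i hi j => hlow 0 i j hi fun y _ => h.survivalWeight_nonneg 0 y j)
    (fun i hi => by
      have := hMw (fun _ => 1) i
      simp only [mul_one] at this
      rw [this, h.sum_survivalWeight 0 hi]
      split_ifs with hiK
      · rw [h.sum_survivalWeight 0 hiK]
        ring
      · ring)
    (fun i hi => hlow _ i 0 hi fun y hy => h.le_survivalWeight_zero 0 hy)
    (fun n j _ => hrec n j) (h.sum_measureReal_busy p)
  have hmass : ∑ i ∈ Finset.range (K + 1), L i = 1 := by
    have h1 := tendsto_finsetSum (Finset.range (K + 1))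
      fun i hi => hL i (Nat.lt_succ_iff.1 (Finset.mem_range.1 hi))
    simp only [h.sum_measureReal_busy p] at h1
    exact tendsto_nhds_unique h1 tendsto_const_nhds
  have hstat : ∀ j ≤ K, L j = ∑ i ∈ Finset.range (K + 1), L i * M i j := by
    intro j hj
    have h1 := tendsto_finsetSum (Finset.range (K + 1))
      fun i hi => (hL i (Nat.lt_succ_iff.1 (Finset.mem_range.1 hi))).mul_const (M i j)
    simp only [← hrec] at h1
    exact tendsto_nhds_unique ((tendsto_add_atTop_iff_nat 1).2 (hL j hj)) h1
  -- C(i,K) vanishes for i < K, so the top binomial moment is the probability of the full state.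
  have htop : ∑ i ∈ Finset.range (K + 1), L i * (i.choose K : ℝ) = L K := by
    rw [Finset.sum_range_succ, Finset.sum_eq_zero fun i hi => by
      rw [Nat.choose_eq_zero_of_lt (Finset.mem_range.1 hi)]; simp]
    simp
  refine ⟨fun k => ∑ i ∈ Finset.range (K + 1), L i * (i.choose k : ℝ), ?_, ?_, fun k => ?_⟩
  · simp only [htop]
    exact hL K le_rfl
  · simpa using hmass
  · simp only [htop]
    set φ := lst P (U 0) ((k + 1 : ℕ) * μ) with hφ
    have hφ0 : 0 < φ := h.lst_pos (mul_nonneg (Nat.cast_nonneg _) h.rate_pos.le) 0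
    -- An admission raises C(i,k+1) by C(i,k), by Pascal's rule; thinning multiplies by φ.
    have hmom : ∀ i ≤ K, ∑ j ∈ Finset.range (K + 1), M i j * (j.choose (k + 1) : ℝ) =
        φ * ((i.choose (k + 1) : ℝ) + if i < K then q * (i.choose k : ℝ) else 0) := by
      intro i hi
      rw [hMw, h.sum_survivalWeight_mul_choose 0 (k + 1) hi, ← hφ]
      split_ifs with hiK
      · rw [h.sum_survivalWeight_mul_choose 0 (k + 1) hiK, ← hφ,
          Nat.choose_succ_succ']
        push_cast
        ring
      · ring
    have hB : ∑ i ∈ Finset.range (K + 1), L i * (i.choose (k + 1) : ℝ) =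
        φ * (∑ i ∈ Finset.range (K + 1), L i * (i.choose (k + 1) : ℝ) +
          q * (∑ i ∈ Finset.range (K + 1), L i * (i.choose k : ℝ) - (K.choose k : ℝ) * L K)) := by
      calc ∑ j ∈ Finset.range (K + 1), L j * (j.choose (k + 1) : ℝ)
          = ∑ j ∈ Finset.range (K + 1), ∑ i ∈ Finset.range (K + 1),
              L i * M i j * (j.choose (k + 1) : ℝ) := by
            refine Finset.sum_congr rfl fun j hj => ?_
            rw [hstat j (Nat.lt_succ_iff.1 (Finset.mem_range.1 hj)), Finset.sum_mul]
        _ = ∑ i ∈ Finset.range (K + 1), L i *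
              (φ * ((i.choose (k + 1) : ℝ) + if i < K then q * (i.choose k : ℝ) else 0)) := by
            rw [Finset.sum_comm]
            refine Finset.sum_congr rfl fun i hi => ?_
            rw [← hmom i (Nat.lt_succ_iff.1 (Finset.mem_range.1 hi)), Finset.mul_sum]
            exact Finset.sum_congr rfl fun j _ => by ring
        _ = _ := by
            -- The state i = K is split off because it admits nobody; this produces the correction
            -- -C(K,k) L_K.
            rw [Finset.sum_range_succ, Finset.sum_range_succ (fun i => L i * (i.choose k : ℝ)),
              Finset.sum_range_succ (fun i => L i * (i.choose (k + 1) : ℝ)), if_neg (lt_irrefl K),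
              Finset.sum_congr rfl fun i hi => by rw [if_pos (Finset.mem_range.1 hi)]]
            have : ∀ i, L i * (φ * ((i.choose (k + 1) : ℝ) + q * (i.choose k : ℝ))) =
                φ * (L i * (i.choose (k + 1) : ℝ)) + φ * q * (L i * (i.choose k : ℝ)) := by
              intro i
              ring
            simp only [this, Finset.sum_add_distrib, ← Finset.mul_sum]
            ring
    rw [div_mul_eq_mul_div, div_eq_iff hφ0.ne']
    linear_combination hB

/-- The limiting blocking probability at a uniform price. -/
theorem tendsto_blocking (h : IsModel P K μ X₀ D U V) (hmean : ∫ ω, U 0 ω ∂P ≠ 0) {p : ℝ}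
    (hp : 0 < tail P (V 0) p) :
    Tendsto (fun n => P.real {ω | busy K X₀ D U V p n ω = K}) atTop
      (𝓝 (∑ j ∈ Finset.range (K + 1), (K.choose j : ℝ) * (tail P (V 0) p)⁻¹ ^ j *
        beta (lst P (U 0)) μ j)⁻¹) := by
  obtain ⟨B, hB, hB0, hrec⟩ := h.exists_limit hmean p
  have := top_moment_eq (K := K) (B := B)
    (c := fun k => (1 - lst P (U 0) (k * μ)) / lst P (U 0) (k * μ)) hp hB0 fun k _ => hrec k
  rwa [this] at hB

/-- The blocking probability vanishes in the limit if nearly no job is willing to pay the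
price. -/
theorem tendsto_blocking_of_tail_eq_zero (h : IsModel P K μ X₀ D U V)
    (hmean : ∫ ω, U 0 ω ∂P ≠ 0) {p : ℝ} (hp : tail P (V 0) p = 0) (hK : 0 < K) :
    Tendsto (fun n => P.real {ω | busy K X₀ D U V p n ω = K}) atTop (𝓝 0) := by
  obtain ⟨B, hB, -, hrec⟩ := h.exists_limit hmean p
  obtain ⟨k, rfl⟩ := Nat.exists_eq_succ_of_ne_zero hK.ne'
  have hs : 0 < ((k + 1 : ℕ) : ℝ) * μ := mul_pos (by positivity) h.rate_pos
  have h1 := hrec k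
  rw [hp, zero_mul] at h1
  have h2 : B (k + 1) = 0 := (mul_eq_zero.1 h1).resolve_left
    (div_pos (sub_pos.2 (h.lst_lt_one hs hmean)) (h.lst_pos hs.le 0)).ne'
  rwa [h2] at hB

end IsModel

/-! ### Reduction of almost sure hypotheses to a pointwise model. -/

lemma measureReal_le_of_hasLaw_expMeasure {Ω : Type*} {mΩ : MeasurableSpace Ω} {P : Measure Ω}
    {μ : ℝ} (hμ : 0 < μ) {T : Ω → ℝ} (hT : HasLaw T (expMeasure μ) P) {a : ℝ} (ha : 0 ≤ a) :
    P.real {ω | a ≤ T ω} = Real.exp (-(μ * a)) := by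
  have := isProbabilityMeasure_expMeasure hμ
  rw [hT.measureReal_eq measurableSet_Ici]
  have hac : expMeasure μ ≪ volume := withDensity_absolutelyContinuous _ _
  have h1 : {x : ℝ | a ≤ x} = Set.Ici a := rfl
  -- The law has a density, hence no atoms, so the closed half-line has the same mass as the open
  -- one computed from the distribution function.
  have : NullSingletonClass (expMeasure μ) := ⟨fun x => hac (by simp)⟩
  have h2 : (expMeasure μ).real (Set.Ici a) = (expMeasure μ).real (Set.Ioi a) :=
    measureReal_congr Ioi_ae_eq_Ici.symm
  rw [h1, h2, ← Set.compl_Iic, probReal_compl_eq_one_sub measurableSet_Iic, ← cdf_eq_real,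
    cdf_expMeasure_eq hμ, if_pos ha]
  ring

lemma ae_nonneg_of_hasLaw_expMeasure {Ω : Type*} {mΩ : MeasurableSpace Ω} {P : Measure Ω}
    [IsProbabilityMeasure P] {μ : ℝ} (hμ : 0 < μ) {T : Ω → ℝ} (hT : HasLaw T (expMeasure μ) P) :
    ∀ᵐ ω ∂P, 0 ≤ T ω := by
  have h := measureReal_le_of_hasLaw_expMeasure hμ hT le_rfl
  rw [mul_zero, neg_zero, Real.exp_zero, measureReal_def,
    ENNReal.toReal_eq_one_iff] at h
  have hs : NullMeasurableSet {ω | 0 ≤ T ω} P :=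
    hT.aemeasurable.nullMeasurable measurableSet_Ici
  exact (mem_ae_iff_prob_eq_one₀ hs).2 h

lemma exists_measurable_nonneg {Ω : Type*} {mΩ : MeasurableSpace Ω} {P : Measure Ω} {T : Ω → ℝ}
    (hT : AEMeasurable T P) (h0 : ∀ᵐ ω ∂P, 0 ≤ T ω) :
    ∃ T' : Ω → ℝ, Measurable T' ∧ (∀ ω, 0 ≤ T' ω) ∧ T =ᵐ[P] T' := by
  refine ⟨fun ω => max (hT.mk T ω) 0, hT.measurable_mk.max measurable_const,
    fun ω => le_max_right _ _, ?_⟩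
  filter_upwards [hT.ae_eq_mk, h0] with ω h h'
  rw [← h, max_eq_left h']

/-- Up to null sets, the primitives may be assumed to be measurable, nonnegative and bounded. -/
lemma exists_isModel {Ω : Type*} {mΩ : MeasurableSpace Ω} {P : Measure Ω} [IsProbabilityMeasure P]
    {K : ℕ} {μ : ℝ} (hμ : 0 < μ) {X₀ : Ω → ℕ} {R U S V : ℕ → Ω → ℝ}
    (hX₀ : AEMeasurable X₀ P) (hX₀K : ∀ᵐ ω ∂P, X₀ ω ≤ K)
    (hR : ∀ n, HasLaw (R n) (expMeasure μ) P)
    (hU : ∀ n, IdentDistrib (U n) (U 0) P P) (hU_nonneg : ∀ᵐ ω ∂P, 0 ≤ U 0 ω)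
    (hS : ∀ n, HasLaw (S n) (expMeasure μ) P)
    (hV : ∀ n, IdentDistrib (V n) (V 0) P P)
    (hindep : iIndepFun (Sum.elim R (Sum.elim U (Sum.elim S V))) P)
    (hindep₀ : IndepFun X₀ (fun ω i => Sum.elim R (Sum.elim U (Sum.elim S V)) i ω) P) :
    ∃ (X₀' : Ω → ℕ) (D' : ℕ ⊕ ℕ → Ω → ℝ) (U' V' : ℕ → Ω → ℝ), IsModel P K μ X₀' D' U' V' ∧
      X₀ =ᵐ[P] X₀' ∧ (∀ l, Sum.elim R S l =ᵐ[P] D' l) ∧ (∀ n, U n =ᵐ[P] U' n) ∧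
        ∀ n, V n =ᵐ[P] V' n := by
  have hD : ∀ l, HasLaw (Sum.elim R S l) (expMeasure μ) P := Sum.rec hR hS
  have hUn : ∀ n, ∀ᵐ ω ∂P, 0 ≤ U n ω := fun n =>
    (hU n).symm.ae_snd (p := fun x => 0 ≤ x) measurableSet_Ici hU_nonneg
  choose D' hD'm hD'0 hD' using fun l =>
    exists_measurable_nonneg (hD l).aemeasurable (ae_nonneg_of_hasLaw_expMeasure hμ (hD l))
  choose U' hU'm hU'0 hU' using fun n =>
    exists_measurable_nonneg (hU n).aemeasurable_fst (hUn n)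
  have hV' : ∀ n, V n =ᵐ[P] (hV n).aemeasurable_fst.mk (V n) := fun n =>
    (hV n).aemeasurable_fst.ae_eq_mk
  have hX' : X₀ =ᵐ[P] fun ω => min (hX₀.mk X₀ ω) K := by
    filter_upwards [hX₀.ae_eq_mk, hX₀K] with ω h h'
    rw [← h, min_eq_left h']
  set V' : ℕ → Ω → ℝ := fun n => (hV n).aemeasurable_fst.mk (V n) with hV'def
  -- The reindexing groups the remaining service times with the service times as one family of
  -- lifetimes; injectivity preserves independence.
  let e : (ℕ ⊕ ℕ) ⊕ (ℕ ⊕ ℕ) → ℕ ⊕ ℕ ⊕ ℕ ⊕ ℕ :=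
    Sum.elim (Sum.elim .inl fun n => .inr (.inr (.inl n)))
      (Sum.elim (fun n => .inr (.inl n)) fun n => .inr (.inr (.inr n)))
  have he : Function.Injective e := by
    rintro ((i | i) | (i | i)) ((j | j) | (j | j)) hij <;> simp_all [e]
  have hfam : ∀ i, Sum.elim R (Sum.elim U (Sum.elim S V)) (e i) =ᵐ[P]
      Sum.elim D' (Sum.elim U' V') i := by
    rintro ((i | i) | (i | i))
    · exact hD' (.inl i)
    · exact hD' (.inr i)
    · exact hU' i
    · exact hV' i
  refine ⟨fun ω => min (hX₀.mk X₀ ω) K, D', U', V', ?_, hX', hD', hU', hV'⟩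
  exact
    { rate_pos := hμ
      measurable_init := hX₀.measurable_mk.min measurable_const
      init_le := fun ω => min_le_right _ _
      measurable_service := hD'm
      service_nonneg := hD'0
      survival := fun l a ha =>
        measureReal_le_of_hasLaw_expMeasure hμ ((hD l).congr (hD' l).symm) ha
      measurable_interarrival := hU'm
      interarrival_nonneg := hU'0
      identDistrib_interarrival := fun n =>
        ((IdentDistrib.of_ae_eq (hU n).aemeasurable_fst (hU' n)).symm.trans (hU n)).trans
          (IdentDistrib.of_ae_eq (hU 0).aemeasurable_fst (hU' 0))
      measurable_valuation := fun n => (hV n).aemeasurable_fst.measurable_mk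
      identDistrib_valuation := fun n =>
        ((IdentDistrib.of_ae_eq (hV n).aemeasurable_fst (hV' n)).symm.trans (hV n)).trans
          (IdentDistrib.of_ae_eq (hV 0).aemeasurable_fst (hV' 0))
      indep := (iIndepFun_congr hfam).1 (hindep.precomp he)
      indep_init := by
        have hψ : Measurable fun (f : ℕ ⊕ ℕ ⊕ ℕ ⊕ ℕ → ℝ) i => f (e i) :=
          measurable_pi_lambda _ fun i => measurable_pi_apply _
        have h1 : IndepFun X₀ (fun ω i => Sum.elim R (Sum.elim U (Sum.elim S V)) (e i) ω) P :=
          hindep₀.comp measurable_id hψ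
        refine h1.congr hX' ?_
        filter_upwards [ae_all_iff.2 hfam] with ω hω
        exact funext hω }

end LossSystem

theorem mainTheorem8 {Ω : Type*} [MeasurableSpace Ω] (P : Measure Ω) [IsProbabilityMeasure P]
    (K : ℕ) (lam μ : ℝ) (hlam : 0 < lam) (hμ : 0 < μ)
    -- initial number of busy servers, and the remaining service times of the initial jobs
    (X₀ : Ω → ℕ) (R : ℕ → Ω → ℝ)
    -- interarrival times, service times, valuations
    (U S V : ℕ → Ω → ℝ)
    (hX₀ : AEMeasurable X₀ P) (hX₀K : ∀ᵐ ω ∂P, X₀ ω ≤ K)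
    (hR : ∀ n, HasLaw (R n) (expMeasure μ) P)
    (hU : ∀ n, IdentDistrib (U n) (U 0) P P)
    (hU_nonneg : ∀ᵐ ω ∂P, 0 ≤ U 0 ω)
    (hU_int : Integrable (U 0) P) (hU_mean : ∫ ω, U 0 ω ∂P = 1 / lam)
    (hS : ∀ n, HasLaw (S n) (expMeasure μ) P)
    (hV : ∀ n, IdentDistrib (V n) (V 0) P P)
    (hindep : iIndepFun (Sum.elim R (Sum.elim U (Sum.elim S V))) P)
    (hindep₀ : IndepFun X₀ (fun ω i => Sum.elim R (Sum.elim U (Sum.elim S V)) i ω) P)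
    (p : ℝ) :
    (0 < LossSystem.tail P (V 0) p →
      Tendsto
        (fun n => P.real {ω | LossSystem.busySeen K (fun _ => p) (X₀ ω) (fun i => R i ω)
          (fun i => U i ω) (fun i => S i ω) (fun i => V i ω) n = K})
        atTop
        (𝓝 (∑ j ∈ Finset.range (K + 1), (K.choose j : ℝ) * (LossSystem.tail P (V 0) p)⁻¹ ^ j *
          LossSystem.beta (LossSystem.lst P (U 0)) μ j)⁻¹)) ∧
    -- the degenerate case, in which the sum above is to be read as infinite
    (LossSystem.tail P (V 0) p = 0 → 0 < K →
      Tendsto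
        (fun n => P.real {ω | LossSystem.busySeen K (fun _ => p) (X₀ ω) (fun i => R i ω)
          (fun i => U i ω) (fun i => S i ω) (fun i => V i ω) n = K})
        atTop (𝓝 0)) := by
  obtain ⟨X₀', D', U', V', hM, hX', hD', hU', hV'⟩ :=
    LossSystem.exists_isModel hμ hX₀ hX₀K hR hU hU_nonneg hS hV hindep hindep₀
  have hbusy : ∀ n, P.real {ω | LossSystem.busySeen K (fun _ => p) (X₀ ω) (fun i => R i ω)
      (fun i => U i ω) (fun i => S i ω) (fun i => V i ω) n = K} =
      P.real {ω | LossSystem.IsModel.busy K X₀' D' U' V' p n ω = K} := by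
    intro n
    refine measureReal_congr (eventuallyEq_set.2 ?_)
    -- There are countably many primitives, so off one null set the entire input sequences agree,
    -- and with them the whole path.
    filter_upwards [hX', ae_all_iff.2 hD', ae_all_iff.2 hU', ae_all_iff.2 hV'] with ω h1 h2 h3 h4
    have hR' : (fun i => R i ω) = fun i => D' (.inl i) ω := funext fun i => h2 (.inl i)
    have hS' : (fun i => S i ω) = fun i => D' (.inr i) ω := funext fun i => h2 (.inr i)
    simp only [h1, h3, h4, hR', hS', LossSystem.IsModel.busy,
      LossSystem.busyCount]
  have htail : LossSystem.tail P (V 0) p = LossSystem.tail P (V' 0) p := by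
    refine measureReal_congr (eventuallyEq_set.2 ?_)
    filter_upwards [hV' 0] with ω hω
    simp only [hω]
  have hlst : LossSystem.lst P (U 0) = LossSystem.lst P (U' 0) := by
    ext s
    refine integral_congr_ae ?_
    filter_upwards [hU' 0] with ω hω
    rw [hω]
  have hmean : ∫ ω, U' 0 ω ∂P ≠ 0 := by
    rw [← integral_congr_ae (hU' 0), hU_mean]
    exact (one_div_pos.2 hlam).ne'
  simp only [hbusy, htail, hlst]
  exact ⟨fun hp => hM.tendsto_blocking hmean hp,
    fun hp hK => hM.tendsto_blocking_of_tail_eq_zero hmean hp hK⟩
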